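/- Let $\rho\in\mathcal S(\mathbb R^3)$ be real, nonnegative, spherically symmetric, with $\int_{\mathbb R^3}\rho\,dx=1$. Put $\rho^\varepsilon(x)=\varepsilon^{-3}\rho(x/\varepsilon)$, $G(x)=\frac1{4\pi|x|}$, $\ell=(\rho,(-\Delta)^{-1}\rho)=(\rho,G*\rho)$, where $(\cdot,\cdot)$ and $\|\cdot\|$ are the inner product (antilinear in the first entry) and norm of $L^2(\mathbb R^3)$, and let $U(t)=e^{it\Delta}$. Let $\gamma,\mu\in\mathbb R$ satisfy either $\gamma\ge 0$ and $\mu\ge0$, or $\gamma<0$ and $0\le\mu<1$. Let $\psi_0=\phi_0+q_0G\in L^2(\mathbb R^3)$ with $q_0\in\mathbb C$, $\phi_0\in\dot H^2(\mathbb R^3)$ (tempered distributions with Fourier transform in $L^1_{loc}(\mathbb R^3)\cap L^2(\mathbb R^3,|k|^4dk)$, identified with continuous functions) and $\phi_0(0)=\gamma|q_0|^{2\mu}q_0$. Fix $T>0$. Then there are constants $\varepsilon_0,C>0$ (which may depend on $\rho,\gamma,\mu,\phi_0,q_0,T$ but not on $\varepsilon$) such that for all $0<\varepsilon<\varepsilon_0$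 the following holds. Let $\psi^\varepsilon\in C([0,T];L^2(\mathbb R^3))$ be the solution of the scaled problem $$\psi^\varepsilon(t)=U(t)\psi_0^\varepsilon-i\int_0^t\Big(-\frac{\varepsilon}{\ell}+\gamma\frac{\varepsilon^{2+2\mu}}{\ell^{2+2\mu}}|(\rho^\varepsilon,\psi^\varepsilon(s))|^{2\mu}\Big)(\rho^\varepsilon,\psi^\varepsilon(s))\,U(t-s)\rho^\varepsilon\,ds,\qquad 0\le t\le T,$$ with initial datum $\psi_0^\varepsilon=\phi_0+q_0\,\rho^\varepsilon*G$, and set $$q^\varepsilon(t)=\frac{\varepsilon}{\ell}(\rho^\varepsilon,\psi^\varepsilon(t)),\qquad \phi^\varepsilon(t)=\psi^\varepsilon(t)-q^\varepsilon(t)\,\rho^\varepsilon*G.$$ Then for every $t\in[0,T]$ the weak gradient $\nabla\phi^\varepsilon(t)$ exists and belongs to $L^2(\mathbb R^3)$, and $$\sup_{t\in[0,T]}\|\nabla\phi^\varepsilon(t)\|\le C,\qquad \sup_{t\in[0,T]}|q^\varepsilon(t)|\le C.$$ -/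

import Mathlib

open MeasureTheory Set
open scoped SchwartzMap FourierTransform ContDiff ENNReal

namespace PointNLS

noncomputable section

/-- Physical space `ℝ³` with its Euclidean norm. -/
abbrev E3 : Type := EuclideanSpace ℝ (Fin 3)

/-- The complex Hilbert space `L²(ℝ³)`. -/
abbrev L2 : Type := Lp ℂ 2 (volume : Measure E3)

/-! ### Homogeneous Sobolev spaces -/

/-- The tempered distribution `u` is given by integration against the function `f`. -/
def IsGivenBy (u : 𝓢'(E3, ℂ)) (f : E3 → ℂ) : Prop :=
  ∀ η : 𝓢(E3, ℂ), Integrable (fun x => η x * f x) ∧ u η = ∫ x, η x * f x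

/-- The homogeneous Sobolev space `Ḣˢ(ℝ³)`: tempered distributions whose Fourier transform is a
locally integrable function that is square integrable with respect to `|k|^{2s} dk`. (Mathlib's
normalisation of the Fourier transform differs from the unitary one in angular frequency by a
dilation and a constant factor, which do not affect membership.) -/
def MemHomogeneousSobolev (s : ℝ) (u : 𝓢'(E3, ℂ)) : Prop :=
  ∃ g : E3 → ℂ, LocallyIntegrable g ∧ IsGivenBy (𝓕 u) g ∧
    MemLp (fun k => ((‖k‖ ^ s : ℝ) : ℂ) * g k) 2

/-! ### The Newtonian potential and the domain of the limit operator -/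

/-- `G(x) = 1 / (4π|x|)`. -/
def G (x : E3) : ℝ := 1 / (4 * Real.pi * ‖x‖)

/-- `ψ = φ + q G` belongs to the nonlinear domain `𝒟` of the limit operator, with regular part
`φ ∈ Ḣ²(ℝ³)` and charge `q`. Elements of `Ḣ²(ℝ³)` are continuous functions; `φ` is the continuous
representative, so that `φ(0)` is meaningful. -/
structure IsInDomain (γ μ : ℝ) (ψ φ : E3 → ℂ) (q : ℂ) : Prop where
  memLp : MemLp ψ 2
  decomposition : ψ =ᵐ[volume] fun x => φ x + q * (G x : ℂ)
  continuous_regular : Continuous φ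
  regular_mem : ∃ u : 𝓢'(E3, ℂ), IsGivenBy u φ ∧ MemHomogeneousSobolev 2 u
  boundary : φ 0 = ((γ * ‖q‖ ^ (2 * μ) : ℝ) : ℂ) * q

/-! ### The form factor -/

/-- `ρ^ε(x) = ε⁻³ ρ(x/ε)`. -/
def rhoEps (ρ : 𝓢(E3, ℝ)) (ε : ℝ) (x : E3) : ℝ := (ε ^ 3)⁻¹ * ρ (ε⁻¹ • x)

/-- The convolution `ρ^ε * G`. -/
def rhoConvG (ρ : 𝓢(E3, ℝ)) (ε : ℝ) (x : E3) : ℝ := ∫ y, rhoEps ρ ε (x - y) * G y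

/-- `ℓ = (ρ, (-Δ)⁻¹ ρ)`, where `(-Δ)⁻¹ ρ = G * ρ`. -/
def ell (ρ : 𝓢(E3, ℝ)) : ℝ := ∫ x, ρ x * ∫ y, ρ (x - y) * G y

theorem memLp_rhoEps (ρ : 𝓢(E3, ℝ)) (ε : ℝ) : MemLp (fun x => (rhoEps ρ ε x : ℂ)) 2 := by
  rcases eq_or_ne ε 0 with rfl | hε
  · simp [rhoEps]
  · let e : E3 ≃L[ℝ] E3 := ContinuousLinearEquiv.smulLeft (Units.mk0 ε⁻¹ (inv_ne_zero hε))
    have h := (SchwartzMap.compCLMOfContinuousLinearEquiv ℝ e ρ).memLp 2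
    exact (h.const_mul ((ε ^ 3)⁻¹)).ofReal

/-- `ρ^ε` as an element of `L²(ℝ³)`. -/
def rhoEpsL2 (ρ : 𝓢(E3, ℝ)) (ε : ℝ) : L2 := (memLp_rhoEps ρ ε).toLp

/-- The pairing `(ρ^ε, ψ)` in `L²(ℝ³)` (`ρ^ε` is real). -/
def pairing (ρ : 𝓢(E3, ℝ)) (ε : ℝ) (ψ : E3 → ℂ) : ℂ := ∫ x, (rhoEps ρ ε x : ℂ) * ψ x

/-! ### The free Schrödinger group -/

/-- The symbol `e^{-i|k|²t}` at `k = 2πξ`, with `ξ` the variable of Mathlib's Fourier transform. -/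
def freeSymbol (t : ℝ) (ξ : E3) : ℂ :=
  Complex.exp (-(Complex.I * ((((2 * Real.pi * ‖ξ‖) ^ 2 * t : ℝ)) : ℂ)))

theorem memLp_freeSymbol_mul (t : ℝ) (f : L2) : MemLp (fun ξ => freeSymbol t ξ * f ξ) 2 := by
  have hc : Continuous (freeSymbol t) := by unfold freeSymbol; fun_prop
  refine (Lp.memLp f).of_le (hc.aestronglyMeasurable.mul (Lp.aestronglyMeasurable f)) ?_
  refine Filter.Eventually.of_forall fun ξ => ?_
  have h1 : ‖freeSymbol t ξ‖ = 1 := by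
    rw [freeSymbol, ← mul_neg, ← Complex.ofReal_neg, mul_comm]
    exact Complex.norm_exp_ofReal_mul_I _
  rw [norm_mul, h1, one_mul]

/-- The free Schrödinger group `U(t) = e^{itΔ}` on `L²(ℝ³)`, a Fourier multiplier. -/
def freeU (t : ℝ) (f : L2) : L2 := 𝓕⁻ ((memLp_freeSymbol_mul t (𝓕 f)).toLp)

/-! ### The scaled problem -/

/-- The coupling
`g(ε, μ, |(ρ^ε, ψ)|^{2μ}) = -ε/ℓ + γ (ε/ℓ)^{2+2μ} |(ρ^ε, ψ)|^{2μ}`. -/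
def coupling (ρ : 𝓢(E3, ℝ)) (γ μ ε : ℝ) (ψ : E3 → ℂ) : ℝ :=
  -(ε / ell ρ) +
    γ * (ε ^ (2 + 2 * μ) / ell ρ ^ (2 + 2 * μ)) * ‖pairing ρ ε ψ‖ ^ (2 * μ)

/-- `ψ ∈ C([0,T]; L²(ℝ³))` solves on `[0,T]` the scaled problem in integral (Duhamel) form,
`ψ(t) = U(t)ψ₀ - i ∫₀ᵗ g(ε, μ, |(ρ^ε, ψ(s))|^{2μ}) (ρ^ε, ψ(s)) U(t-s)ρ^ε ds`,
with initial datum `ψ₀`. -/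
structure IsScaledSolution (ρ : 𝓢(E3, ℝ)) (γ μ ε T : ℝ) (ψ₀ : E3 → ℂ) (ψ : ℝ → L2) : Prop where
  continuousOn : ContinuousOn ψ (Icc 0 T)
  initial : (ψ 0 : E3 → ℂ) =ᵐ[volume] ψ₀
  duhamel : ∀ t ∈ Icc (0 : ℝ) T,
    ψ t = freeU t (ψ 0) - Complex.I •
      ∫ s in (0 : ℝ)..t,
        ((coupling ρ γ μ ε (ψ s) : ℂ) * pairing ρ ε (ψ s)) • freeU (t - s) (rhoEpsL2 ρ ε)

/-- The approximate charge `q^ε = (ε/ℓ) (ρ^ε, ψ)`. -/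
def charge (ρ : 𝓢(E3, ℝ)) (ε : ℝ) (ψ : E3 → ℂ) : ℂ := ((ε / ell ρ : ℝ) : ℂ) * pairing ρ ε ψ

/-- The regular part `φ^ε = ψ - q^ε ρ^ε * G`. -/
def regularPart (ρ : 𝓢(E3, ℝ)) (ε : ℝ) (ψ : E3 → ℂ) (x : E3) : ℂ :=
  ψ x - charge ρ ε ψ * (rhoConvG ρ ε x : ℂ)

/-! ### The `L²` norm of the gradient -/

/-- `v` is the weak (distributional) gradient of `u`. -/
structure HasWeakGradient (u : E3 → ℂ) (v : E3 → EuclideanSpace ℂ (Fin 3)) : Prop where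
  locallyIntegrable : LocallyIntegrable u
  locallyIntegrable_grad : LocallyIntegrable v
  integral_eq : ∀ η : E3 → ℝ, ContDiff ℝ ∞ η → HasCompactSupport η → ∀ j : Fin 3,
    ∫ x, (fderiv ℝ η x (EuclideanSpace.single j 1) : ℂ) * u x = -∫ x, (η x : ℂ) * v x j

/-- `‖∇u‖_{L²}`, with value `∞` unless `u` has a weak gradient that is square integrable. The weak
gradient is unique almost everywhere, so the infimum is over at most one value. -/
def gradNorm (u : E3 → ℂ) : ℝ≥0∞ :=
  ⨅ (v : E3 → EuclideanSpace ℂ (Fin 3)) (_ : HasWeakGradient u v), eLpNorm v 2 volume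

end

end PointNLS

namespace PointNLS

/-! The charge `q^ε` is the coefficient of an orthogonal projection. On the Fourier side `ρ^ε * G`
is `r(k) / (2π|k|)²` with `r(k) = ρ̂(εk)`, and `(ρ^ε, G * ρ^ε) = ℓ/ε`. Hence, with `q^ε = (ε/ℓ)(ρ^ε,
ψ)`, the two parts of `ψ = φ^ε + q^ε ρ^ε * G` are orthogonal for the kinetic energy: `‖∇ψ‖² =
‖∇φ^ε‖² + (ℓ/ε)|q^ε|²` (`integral_kinetic_sub`). The linear part of the coupling contributes
`-(ε/ℓ)|(ρ^ε, ψ)|² = -(ℓ/ε)|q^ε|²` to the Hamiltonian and cancels the singular term. What is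
conserved is `‖∇φ^ε‖² + γ/(μ+1) |q^ε|^(2μ+2)`, with no explicit `ε`
(`IsScaledSolution.conservation`).

Conservation of mass and energy is proved in Fourier variables, where Duhamel's formula is explicit
at each wave vector and can be differentiated in time (`IsScaledSolution.fourier_ae`,
`mass_energy_conservation`). Both conserved quantities are bounded at time zero uniformly in `ε`
(`exists_initial_mass_bound`, `initial_bounds`).

For `γ ≥ 0` the energy alone bounds `‖∇φ^ε‖`. For `γ < 0` the negative term must be absorbed:
`exists_charge_bound` gives `|q^ε|² ≤ K(1 + ‖∇φ^ε‖)` with `K` depending on the mass but not on `ε`,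
so this term grows at most like `‖∇φ^ε‖^(μ+1)`, and `μ + 1 < 2` closes the estimate. The same
inequality bounds the charge in both cases. -/

/-! ### Singular weights and the Fourier transform of `1/|x|`. -/

/-- In polar coordinates the Jacobian `r²` cancels the singularity and leaves `1/(1 + r²)`. This
weight is the common dominating function for everything that behaves like `|k|⁻²` at the origin and
`|k|⁻⁴` at infinity. -/
theorem integrable_inv_sq_mul_one_add_sq :
    Integrable (fun k : E3 => (‖k‖ ^ 2 * (1 + ‖k‖ ^ 2))⁻¹) := by
  have h := integrable_fun_norm_addHaar (volume : Measure E3)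
    (f := fun r : ℝ => (r ^ 2 * (1 + r ^ 2))⁻¹)
  refine h.2 ?_
  have h1 : IntegrableOn (fun r : ℝ => (1 + r ^ 2)⁻¹) (Ioi 0) :=
    integrable_inv_one_add_sq.integrableOn
  refine h1.congr_fun (fun r hr => ?_) measurableSet_Ioi
  have hr' : (r : ℝ) ≠ 0 := ne_of_gt hr
  simp only [finrank_euclideanSpace, Fintype.card_fin, smul_eq_mul]
  field_simp

theorem exists_norm_pow_mul_le (η : 𝓢(E3, ℂ)) (n : ℕ) :
    ∃ C : ℝ, 0 ≤ C ∧ ∀ x, ‖x‖ ^ n * ‖η x‖ ≤ C := by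
  obtain ⟨C, hC⟩ := η.decay n 0
  refine ⟨C, hC.1.le, fun x => ?_⟩
  simpa using hC.2 x

theorem integrable_schwartz_mul_inv_sq (η : 𝓢(E3, ℂ)) :
    Integrable (fun k => η k * (((‖k‖ ^ 2)⁻¹ : ℝ) : ℂ)) := by
  obtain ⟨C₀, h₀, hC₀⟩ := exists_norm_pow_mul_le η 0
  obtain ⟨C₂, h₂, hC₂⟩ := exists_norm_pow_mul_le η 2
  refine (integrable_inv_sq_mul_one_add_sq.const_mul (C₀ + C₂)).mono' ?_ ?_
  · exact η.continuous.aestronglyMeasurable.mul (by fun_prop)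
  · refine Filter.Eventually.of_forall fun k => ?_
    have h1 := hC₀ k
    have h2 := hC₂ k
    rw [norm_mul, Complex.norm_real, Real.norm_of_nonneg (by positivity), mul_inv,
      mul_comm (‖k‖ ^ 2)⁻¹, ← mul_assoc]
    gcongr
    rw [← div_eq_mul_inv, le_div_iff₀ (by positivity)]
    rw [pow_zero, one_mul] at h1
    nlinarith

theorem integrable_schwartz_mul_inv_norm (η : 𝓢(E3, ℂ)) :
    Integrable (fun k => η k * ((‖k‖⁻¹ : ℝ) : ℂ)) := by
  obtain ⟨C₀, h₀, hC₀⟩ := exists_norm_pow_mul_le η 1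
  obtain ⟨C₂, h₂, hC₂⟩ := exists_norm_pow_mul_le η 3
  refine (integrable_inv_sq_mul_one_add_sq.const_mul (C₀ + C₂)).mono' ?_ ?_
  · exact η.continuous.aestronglyMeasurable.mul (by fun_prop)
  · refine Filter.Eventually.of_forall fun k => ?_
    have h1 := hC₀ k
    have h3 := hC₂ k
    rw [norm_mul, Complex.norm_real, Real.norm_of_nonneg (by positivity)]
    rcases eq_or_ne k 0 with rfl | hk
    · simp
    have hk : 0 < ‖k‖ := norm_pos_iff.2 hk
    rw [← div_eq_mul_inv, ← div_eq_mul_inv, div_le_div_iff₀ hk (by positivity)]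
    nlinarith

theorem integral_fourier_mul_eq_of_integrable {f g : E3 → ℂ} (hf : Integrable f)
    (hg : Integrable g) : ∫ x, 𝓕 f x * g x = ∫ x, f x * 𝓕 g x := by
  simpa using! VectorFourier.integral_fourierIntegral_smul_eq_flip (L := innerₗ E3)
    Real.continuous_fourierChar continuous_inner hf hg

theorem integral_fourier_mul_gaussian (η : 𝓢(E3, ℂ)) {b : ℝ} (hb : 0 < b) :
    ∫ x, (𝓕 η : 𝓢(E3, ℂ)) x * (Real.exp (-b * ‖x‖ ^ 2) : ℂ) =
      ((Real.pi / b) ^ (3 / 2 : ℝ) : ℝ) *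
        ∫ k, η k * (Real.exp (-(Real.pi ^ 2 * ‖k‖ ^ 2 / b)) : ℂ) := by
  have hg : Integrable (fun x : E3 => Complex.exp (-(b : ℂ) * ‖x‖ ^ 2)) := by
    simpa using GaussianFourier.integrable_cexp_neg_mul_sq_norm_add (V := E3) (b := (b : ℂ))
      (by simpa using hb) 0 0
  have h := integral_fourier_mul_eq_of_integrable η.integrable hg
  have hF : ∀ w : E3, 𝓕 (fun x : E3 => Complex.exp (-(b : ℂ) * ‖x‖ ^ 2)) w =
      (((Real.pi / b) ^ (3 / 2 : ℝ) : ℝ) : ℂ) *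
        (Real.exp (-(Real.pi ^ 2 * ‖w‖ ^ 2 / b)) : ℂ) := by
    intro w
    rw [fourier_gaussian_innerProductSpace (by simpa using hb) w]
    rw [Complex.ofReal_cpow (by positivity)]
    congr 1
    · simp
    · push_cast; congr 1; ring
  simp_rw [hF] at h
  rw [← integral_const_mul]
  convert h using 1
  · simp [SchwartzMap.fourier_coe]
  · congr 1; ext k; ring

/-- Writes `1/|x|` as a superposition of Gaussians, whose Fourier transforms are explicit. -/
theorem integral_gaussian_sq_Ioi {r : ℝ} (hr : 0 < r) :
    IntegrableOn (fun s : ℝ => Real.exp (-s ^ 2 * r ^ 2)) (Ioi 0) ∧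
      ∫ s in Ioi (0 : ℝ), Real.exp (-s ^ 2 * r ^ 2) = Real.sqrt Real.pi / 2 * r⁻¹ := by
  have he : (fun s : ℝ => Real.exp (-s ^ 2 * r ^ 2)) = fun s => Real.exp (-r ^ 2 * s ^ 2) := by
    ext s; ring_nf
  rw [he]
  refine ⟨(integrable_exp_neg_mul_sq (by positivity)).integrableOn, ?_⟩
  rw [integral_gaussian_Ioi, Real.sqrt_div Real.pi_pos.le, Real.sqrt_sq hr.le]
  ring

/-- The substitution `y = s⁻²` reduces this to an exponential integral. It sums the transformed
Gaussians to a multiple of `1/|k|²`. -/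
theorem integral_rpow_neg_three_mul_exp_Ioi {c : ℝ} (hc : 0 < c) :
    IntegrableOn (fun s : ℝ => s ^ (-3 : ℝ) * Real.exp (-(c * s ^ (-2 : ℝ)))) (Ioi 0) ∧
      ∫ s in Ioi (0 : ℝ), s ^ (-3 : ℝ) * Real.exp (-(c * s ^ (-2 : ℝ))) = 1 / 2 * c⁻¹ := by
  have h1 := integrableOn_Ioi_comp_rpow_iff (fun y : ℝ => Real.exp (-c * y))
    (p := -2) (by norm_num)
  have h2 := integral_comp_rpow_Ioi (fun y : ℝ => Real.exp (-c * y)) (p := -2) (by norm_num)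
  have he : (fun x : ℝ => (|(-2 : ℝ)| * x ^ ((-2 : ℝ) - 1)) • Real.exp (-c * x ^ (-2 : ℝ))) =
      fun x => 2 * (x ^ (-3 : ℝ) * Real.exp (-(c * x ^ (-2 : ℝ)))) := by
    ext x
    norm_num
    ring
  rw [he] at h1 h2
  constructor
  · have := (h1.2 (exp_neg_integrableOn_Ioi 0 hc)).const_mul (1 / 2)
    refine this.congr (Filter.Eventually.of_forall fun x => ?_)
    ring
  · rw [integral_const_mul, integral_exp_mul_Ioi (by linarith)] at h2
    have : -Real.exp (-c * 0) / -c = c⁻¹ := by simp [neg_div_neg_eq]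
    rw [this] at h2
    linarith

/-- Superposition of a family of positive kernels: the double integral may be computed in either
order. -/
theorem integral_integral_kernel {f : E3 → ℂ} {K : ℝ → E3 → ℝ} {N : E3 → ℝ}
    (hf : AEStronglyMeasurable f) (hK : Measurable (Function.uncurry K))
    (hK0 : ∀ s x, 0 < s → 0 ≤ K s x)
    (hN : ∀ x, x ≠ 0 → IntegrableOn (fun s => K s x) (Ioi 0) ∧ ∫ s in Ioi (0 : ℝ), K s x = N x)
    (hfN : Integrable fun x => f x * (N x : ℂ)) :
    ∫ s in Ioi (0 : ℝ), ∫ x, f x * (K s x : ℂ) = ∫ x, f x * (N x : ℂ) := by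
  have hne : ∀ᵐ x : E3, x ≠ 0 := by
    simp [ae_iff]
  have hmeas : AEStronglyMeasurable (fun p : ℝ × E3 => f p.2 * (K p.1 p.2 : ℂ))
      ((volume.restrict (Ioi (0 : ℝ))).prod volume) := by
    refine hf.comp_snd.mul ?_
    exact (Complex.measurable_ofReal.comp hK).aestronglyMeasurable
  have hint : Integrable (Function.uncurry fun (s : ℝ) (x : E3) => f x * (K s x : ℂ))
      ((volume.restrict (Ioi (0 : ℝ))).prod volume) := by
    refine (integrable_prod_iff' hmeas).2 ⟨?_, ?_⟩
    · filter_upwards [hne] with x hx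
      exact ((hN x hx).1.ofReal).const_mul (f x)
    · refine hfN.norm.congr ?_
      filter_upwards [hne] with x hx
      rw [norm_mul, Complex.norm_real, ← (hN x hx).2, Real.norm_of_nonneg, ← integral_const_mul]
      · refine setIntegral_congr_fun measurableSet_Ioi fun s hs => ?_
        simp [abs_of_nonneg (hK0 s x hs)]
      · exact setIntegral_nonneg measurableSet_Ioi fun s hs => hK0 s x hs
  rw [integral_integral_swap hint]
  refine integral_congr_ae ?_
  filter_upwards [hne] with x hx
  rw [integral_const_mul, integral_complex_ofReal, (hN x hx).2]

/-- Subordination: decompose `1/|x|` into Gaussians, transform each one, and resum on the other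
side. -/
theorem integral_fourier_mul_inv_norm (η : 𝓢(E3, ℂ)) :
    ∫ x, (𝓕 η : 𝓢(E3, ℂ)) x * ((‖x‖⁻¹ : ℝ) : ℂ) =
      ((Real.pi⁻¹ : ℝ) : ℂ) * ∫ k, η k * (((‖k‖ ^ 2)⁻¹ : ℝ) : ℂ) := by
  have hπ : Real.sqrt Real.pi ≠ 0 := (Real.sqrt_pos.2 Real.pi_pos).ne'
  have hL := integral_integral_kernel (f := (𝓕 η : 𝓢(E3, ℂ)))
    (K := fun s x => Real.exp (-s ^ 2 * ‖x‖ ^ 2))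
    (N := fun x => Real.sqrt Real.pi / 2 * ‖x‖⁻¹) (𝓕 η : 𝓢(E3, ℂ)).continuous.aestronglyMeasurable
    (by unfold Function.uncurry; fun_prop) (fun s x _ => Real.exp_nonneg _)
    (fun x hx => integral_gaussian_sq_Ioi (norm_pos_iff.2 hx))
    (((integrable_schwartz_mul_inv_norm (𝓕 η)).const_mul
      ((Real.sqrt Real.pi / 2 : ℝ) : ℂ)).congr
      (Filter.Eventually.of_forall fun x => by push_cast; ring))
  have hR := integral_integral_kernel (f := η)
    (K := fun s k => s ^ (-3 : ℝ) * Real.exp (-((Real.pi ^ 2 * ‖k‖ ^ 2) * s ^ (-2 : ℝ))))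
    (N := fun k => 1 / 2 * (Real.pi ^ 2 * ‖k‖ ^ 2)⁻¹) η.continuous.aestronglyMeasurable
    (by unfold Function.uncurry; fun_prop)
    (fun s x hs => mul_nonneg (Real.rpow_nonneg hs.le _) (Real.exp_nonneg _))
    (fun x hx => integral_rpow_neg_three_mul_exp_Ioi
      (mul_pos (by positivity) (pow_pos (norm_pos_iff.2 hx) 2)))
    (((integrable_schwartz_mul_inv_sq η).const_mul
      ((1 / 2 * (Real.pi ^ 2)⁻¹ : ℝ) : ℂ)).congr
      (Filter.Eventually.of_forall fun x => by push_cast; rw [mul_inv]; ring))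
  -- The Gaussian identity with `b = s²`; its prefactor `(π/s²)^(3/2)` supplies the weight `s⁻³` of
  -- the second kernel.
  have hmid : ∫ s in Ioi (0 : ℝ), ∫ x, (𝓕 η : 𝓢(E3, ℂ)) x * (Real.exp (-s ^ 2 * ‖x‖ ^ 2) : ℂ) =
      ((Real.sqrt Real.pi ^ 3 : ℝ) : ℂ) * ∫ s in Ioi (0 : ℝ), ∫ k, η k *
        ((s ^ (-3 : ℝ) * Real.exp (-((Real.pi ^ 2 * ‖k‖ ^ 2) * s ^ (-2 : ℝ))) : ℝ) : ℂ) := by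
    rw [← integral_const_mul]
    refine setIntegral_congr_fun measurableSet_Ioi fun s hs => ?_
    have hs : 0 < s := hs
    rw [integral_fourier_mul_gaussian η (b := s ^ 2) (by positivity), ← integral_const_mul,
      ← integral_const_mul]
    congr 1; ext k
    have e1 : (Real.pi / s ^ 2) ^ (3 / 2 : ℝ) = Real.sqrt Real.pi ^ 3 * s ^ (-3 : ℝ) := by
      rw [Real.div_rpow Real.pi_pos.le (by positivity), Real.sqrt_eq_rpow, ← Real.rpow_natCast,
        ← Real.rpow_natCast, ← Real.rpow_mul Real.pi_pos.le, ← Real.rpow_mul hs.le,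
        Real.rpow_neg hs.le, div_eq_mul_inv]
      norm_num
    have e2 : Real.pi ^ 2 * ‖k‖ ^ 2 / s ^ 2 = Real.pi ^ 2 * ‖k‖ ^ 2 * s ^ (-2 : ℝ) := by
      rw [Real.rpow_neg hs.le, div_eq_mul_inv]
      norm_num
    rw [e1, e2]
    push_cast
    ring
  rw [hL, hR] at hmid
  have hl : ∀ x : E3, (𝓕 η : 𝓢(E3, ℂ)) x * ((Real.sqrt Real.pi / 2 * ‖x‖⁻¹ : ℝ) : ℂ) =
      ((Real.sqrt Real.pi / 2 : ℝ) : ℂ) * ((𝓕 η : 𝓢(E3, ℂ)) x * ((‖x‖⁻¹ : ℝ) : ℂ)) := by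
    intro x; push_cast; ring
  have hr : ∀ x : E3, η x * ((1 / 2 * (Real.pi ^ 2 * ‖x‖ ^ 2)⁻¹ : ℝ) : ℂ) =
      ((1 / 2 * (Real.pi ^ 2)⁻¹ : ℝ) : ℂ) * (η x * (((‖x‖ ^ 2)⁻¹ : ℝ) : ℂ)) := by
    intro x; push_cast; rw [mul_inv]; ring
  simp_rw [hl, hr, integral_const_mul] at hmid
  have hc : ((Real.sqrt Real.pi / 2 : ℝ) : ℂ) ≠ 0 := by
    rw [Complex.ofReal_ne_zero]; positivity
  refine mul_left_cancel₀ hc (hmid.trans ?_)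
  rw [← mul_assoc, ← mul_assoc, ← Complex.ofReal_mul, ← Complex.ofReal_mul]
  congr 2
  have : Real.sqrt Real.pi ^ 2 = Real.pi := Real.sq_sqrt Real.pi_pos.le
  have hp := Real.pi_ne_zero
  rw [pow_succ, this]
  field_simp

/-! ### Functions with a distributional Fourier transform. -/

/-- `(2π|k|)⁻²`, the symbol of `(-Δ)⁻¹`. -/
noncomputable def invKinetic (k : E3) : ℝ := ((2 * Real.pi * ‖k‖) ^ 2)⁻¹

/-- `h` is the Fourier transform of the function `u` in the sense of tempered distributions. -/
def HasFourier (u h : E3 → ℂ) : Prop :=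
  ∀ η : 𝓢(E3, ℂ), Integrable (fun x => η x * u x) ∧ Integrable (fun k => η k * h k) ∧
    ∫ x, (𝓕 η : 𝓢(E3, ℂ)) x * u x = ∫ k, η k * h k

theorem HasFourier.add {u h u' h' : E3 → ℂ} (H : HasFourier u h) (H' : HasFourier u' h') :
    HasFourier (fun x => u x + u' x) (fun k => h k + h' k) := by
  intro η
  simp_rw [mul_add]
  refine ⟨(H η).1.add (H' η).1, (H η).2.1.add (H' η).2.1, ?_⟩
  rw [integral_add (H _).1 (H' _).1, integral_add (H η).2.1 (H' η).2.1, (H η).2.2, (H' η).2.2]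

theorem HasFourier.const_mul {u h : E3 → ℂ} (H : HasFourier u h) (c : ℂ) :
    HasFourier (fun x => c * u x) (fun k => c * h k) := by
  intro η
  simp_rw [mul_left_comm _ c]
  refine ⟨(H η).1.const_mul c, (H η).2.1.const_mul c, ?_⟩
  rw [integral_const_mul, integral_const_mul, (H η).2.2]

theorem HasFourier.congr {u h u' h' : E3 → ℂ} (H : HasFourier u h) (hu : u =ᵐ[volume] u')
    (hh : h =ᵐ[volume] h') : HasFourier u' h' := by
  intro η
  have e1 : ∀ χ : 𝓢(E3, ℂ), (fun x => χ x * u x) =ᵐ[volume] fun x => χ x * u' x := fun χ => by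
    filter_upwards [hu] with x hx; rw [hx]
  have e2 : (fun x => η x * h x) =ᵐ[volume] fun x => η x * h' x := by
    filter_upwards [hh] with x hx; rw [hx]
  refine ⟨(H η).1.congr (e1 η), (H η).2.1.congr e2, ?_⟩
  rw [← integral_congr_ae (e1 _), ← integral_congr_ae e2, (H η).2.2]

theorem IsGivenBy.hasFourier {u : 𝓢'(E3, ℂ)} {φ g : E3 → ℂ} (hu : IsGivenBy u φ)
    (hg : IsGivenBy (𝓕 u) g) : HasFourier φ g := by
  intro η
  refine ⟨(hu η).1, (hg η).1, ?_⟩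
  rw [← (hg η).2, ← (hu _).2, TemperedDistribution.fourier_apply]

theorem integral_fourier_smul_Lp {F : Type*} [NormedAddCommGroup F] [InnerProductSpace ℂ F]
    [CompleteSpace F] (f : Lp F 2 (volume : Measure E3)) (η : 𝓢(E3, ℂ)) :
    ∫ x, (𝓕 η : 𝓢(E3, ℂ)) x • f x = ∫ k, η k • (𝓕 f : Lp F 2 (volume : Measure E3)) k := by
  have h := congrArg (fun u : 𝓢'(E3, F) => u η) (Lp.fourier_toTemperedDistribution_eq f)
  simpa using h

theorem integrable_schwartz_smul_of_memLp {F : Type*} [NormedAddCommGroup F] [NormedSpace ℂ F]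
    (η : 𝓢(E3, ℂ)) {f : E3 → F} (hf : MemLp f 2) : Integrable (fun x => η x • f x) := by
  have := (hf.smul (η.memLp 2) : MemLp _ 1 volume)
  exact memLp_one_iff_integrable.1 this

theorem hasFourier_L2 (f : L2) : HasFourier f (𝓕 f : L2) := fun η =>
  ⟨integrable_schwartz_smul_of_memLp η (Lp.memLp f),
    integrable_schwartz_smul_of_memLp η (Lp.memLp _), integral_fourier_smul_Lp f η⟩

theorem integrable_schwartz_mul_invKinetic (η : 𝓢(E3, ℂ)) :
    Integrable (fun k => η k * (invKinetic k : ℂ)) := by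
  refine ((integrable_schwartz_mul_inv_sq η).const_mul
    ((((2 * Real.pi) ^ 2)⁻¹ : ℝ) : ℂ)).congr (Filter.Eventually.of_forall fun k => ?_)
  simp only [invKinetic]
  rw [mul_pow, mul_inv]
  push_cast
  ring

/-- The Fourier transform of the Newtonian potential. -/
theorem hasFourier_G : HasFourier (fun x => (G x : ℂ)) (fun k => (invKinetic k : ℂ)) := by
  have hG : ∀ x : E3, (G x : ℂ) = (((4 * Real.pi)⁻¹ : ℝ) : ℂ) * ((‖x‖⁻¹ : ℝ) : ℂ) := by
    intro x; rw [G, one_div, mul_inv]; push_cast; ring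
  intro η
  refine ⟨?_, integrable_schwartz_mul_invKinetic η, ?_⟩
  · refine ((integrable_schwartz_mul_inv_norm η).const_mul (((4 * Real.pi)⁻¹ : ℝ) : ℂ)).congr
      (Filter.Eventually.of_forall fun x => ?_)
    simp only [hG]
    ring
  · have hK : ∀ k : E3, (invKinetic k : ℂ) =
        (((4 * Real.pi ^ 2)⁻¹ : ℝ) : ℂ) * (((‖k‖ ^ 2)⁻¹ : ℝ) : ℂ) := by
      intro k
      rw [invKinetic, mul_pow, mul_inv, ← Complex.ofReal_mul]
      congr 3
      ring
    simp_rw [hG, hK, mul_left_comm _ (Complex.ofReal (_)⁻¹) (Complex.ofReal _),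
      integral_const_mul, integral_fourier_mul_inv_norm]
    rw [← mul_assoc, ← Complex.ofReal_mul]
    congr 3
    rw [← mul_inv]; congr 1; ring

/-- Integrability against every Schwartz function includes integrability against a bump equal to one
near a given point. -/
theorem HasFourier.locallyIntegrable {u h : E3 → ℂ} (H : HasFourier u h) :
    LocallyIntegrable u ∧ LocallyIntegrable h := by
  have key : ∀ f : E3 → ℂ, (∀ η : 𝓢(E3, ℂ), Integrable fun x => η x * f x) →
      LocallyIntegrable f := by
    intro f hf x
    let b : ContDiffBump x := ⟨1, 2, one_pos, one_lt_two⟩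
    have hg₁ : HasCompactSupport (Complex.ofRealCLM ∘ b) := b.hasCompactSupport.comp_left rfl
    have hg₂ : ContDiff ℝ ∞ (Complex.ofRealCLM ∘ b) := Complex.ofRealCLM.contDiff.comp b.contDiff
    refine ⟨Metric.closedBall x 1, Metric.closedBall_mem_nhds x one_pos, ?_⟩
    refine (hf (hg₁.toSchwartzMap hg₂)).integrableOn.congr_fun (fun y hy => ?_)
      Metric.isClosed_closedBall.measurableSet
    have : b y = 1 := b.one_of_mem_closedBall hy
    simp [this]
  exact ⟨key u fun η => (H η).1, key h fun η => (H η).2.1⟩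

theorem HasFourier.unique {u h h' : E3 → ℂ} (H : HasFourier u h) (H' : HasFourier u h') :
    h =ᵐ[volume] h' := by
  refine ae_eq_of_integral_contDiff_smul_eq H.locallyIntegrable.2 H'.locallyIntegrable.2 ?_
  intro g hg hgc
  have hg₁ : HasCompactSupport (Complex.ofRealCLM ∘ g) := hgc.comp_left rfl
  have hg₂ : ContDiff ℝ ∞ (Complex.ofRealCLM ∘ g) := Complex.ofRealCLM.contDiff.comp hg
  have := (H (hg₁.toSchwartzMap hg₂)).2.2.symm.trans (H' (hg₁.toSchwartzMap hg₂)).2.2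
  simpa using this

/-- The inverse transform of `2πi k h(k)` is a weak gradient of `u`, and Plancherel for
vector-valued functions computes its norm. Exhibiting one weak gradient suffices, because `gradNorm`
is an infimum. -/
theorem gradNorm_le_of_hasFourier {u h : E3 → ℂ} (H : HasFourier u h)
    (hk : MemLp (fun k : E3 => ((2 * Real.pi * ‖k‖ : ℝ) : ℂ) * h k) 2) :
    gradNorm u ≤ eLpNorm (fun k : E3 => ((2 * Real.pi * ‖k‖ : ℝ) : ℂ) * h k) 2 volume := by
  let W : E3 → EuclideanSpace ℂ (Fin 3) := fun k =>
    (2 * Real.pi * Complex.I * h k) • WithLp.toLp 2 (fun j => ((k j : ℝ) : ℂ))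
  have hkn : ∀ k : E3, ‖(WithLp.toLp 2 (fun j => ((k j : ℝ) : ℂ)) : EuclideanSpace ℂ (Fin 3))‖
      = ‖k‖ := by
    intro k
    simp [EuclideanSpace.norm_eq]
  have hWn : ∀ k, ‖W k‖ = ‖((2 * Real.pi * ‖k‖ : ℝ) : ℂ) * h k‖ := by
    intro k
    simp only [W, norm_smul, hkn, norm_mul, Complex.norm_real, Complex.norm_I, norm_norm,
      Complex.norm_ofNat, Real.norm_ofNat]
    ring
  have hWm : AEStronglyMeasurable W := by
    have h1 : AEStronglyMeasurable (fun k => 2 * Real.pi * Complex.I * h k) :=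
      aestronglyMeasurable_const.mul H.locallyIntegrable.2.aestronglyMeasurable
    have h2 : Continuous fun k : E3 =>
        (WithLp.toLp 2 (fun j => ((k j : ℝ) : ℂ)) : EuclideanSpace ℂ (Fin 3)) := by
      fun_prop
    exact h1.smul h2.aestronglyMeasurable
  have hW : MemLp W 2 := by
    refine hk.of_le hWm (Filter.Eventually.of_forall fun k => (hWn k).le)
  let v : Lp (EuclideanSpace ℂ (Fin 3)) 2 (volume : Measure E3) := 𝓕⁻ hW.toLp
  have hv : HasWeakGradient u v := by
    refine ⟨H.locallyIntegrable.1, (Lp.memLp v).locallyIntegrable (by norm_num), ?_⟩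
    intro η hη hηc j
    have hg₁ : HasCompactSupport (Complex.ofRealCLM ∘ η) := hηc.comp_left rfl
    have hg₂ : ContDiff ℝ ∞ (Complex.ofRealCLM ∘ η) := Complex.ofRealCLM.contDiff.comp hη
    let χ : 𝓢(E3, ℂ) := hg₁.toSchwartzMap hg₂
    let e : E3 := EuclideanSpace.single j 1
    let θ : 𝓢(E3, ℂ) := LineDeriv.lineDerivOp e χ
    have hθ : ∀ x, θ x = (fderiv ℝ η x e : ℂ) := by
      intro x
      have hd : HasFDerivAt (Complex.ofRealCLM ∘ η) (Complex.ofRealCLM.comp (fderiv ℝ η x)) x :=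
        Complex.ofRealCLM.hasFDerivAt.comp x
          ((hη.differentiable (by simp)).differentiableAt.hasFDerivAt)
      have : fderiv ℝ χ x = Complex.ofRealCLM.comp (fderiv ℝ η x) := hd.fderiv
      simp only [θ]
      rw [SchwartzMap.lineDerivOp_apply_eq_fderiv, this]
      simp
    -- The inverse transform turns `∂ⱼ` into `-2πi kⱼ`; this minus sign is the one in the
    -- integration by parts.
    have hinv : ∀ k, (𝓕⁻ θ : 𝓢(E3, ℂ)) k =
        -(2 * Real.pi * Complex.I) * ((k j : ℝ) : ℂ) * (𝓕⁻ χ : 𝓢(E3, ℂ)) k := by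
      intro k
      simp only [θ]
      have : (fun x : E3 => inner ℝ x e).HasTemperateGrowth := by fun_prop
      rw [SchwartzMap.fourierInv_lineDerivOp_eq, _root_.smul_apply,
        SchwartzMap.smulLeftCLM_apply_apply this]
      simp [e, EuclideanSpace.inner_single_right]
      ring
    have h1 := (H (𝓕⁻ θ)).2.2
    rw [FourierTransform.fourier_fourierInv_eq] at h1
    have h2 := integral_fourier_smul_Lp v (𝓕⁻ χ)
    rw [FourierTransform.fourier_fourierInv_eq, FourierTransform.fourier_fourierInv_eq] at h2
    have hint1 : Integrable fun x => χ x • v x :=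
      integrable_schwartz_smul_of_memLp χ (Lp.memLp v)
    have hint2 : Integrable fun k => (𝓕⁻ χ : 𝓢(E3, ℂ)) k • W k :=
      integrable_schwartz_smul_of_memLp _ hW
    have h3 : ∫ x, χ x * v x j = ∫ k, (𝓕⁻ χ : 𝓢(E3, ℂ)) k * W k j := by
      have e1 : ∫ k, (𝓕⁻ χ : 𝓢(E3, ℂ)) k • hW.toLp W k = ∫ k, (𝓕⁻ χ : 𝓢(E3, ℂ)) k • W k := by
        refine integral_congr_ae ?_
        filter_upwards [hW.coeFn_toLp] with k hk'
        rw [hk']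
      rw [e1] at h2
      let P : EuclideanSpace ℂ (Fin 3) →L[ℂ] ℂ := EuclideanSpace.proj j
      have h4 := congrArg P h2
      rw [← P.integral_comp_comm hint1, ← P.integral_comp_comm hint2] at h4
      simpa [P] using h4
    have h5 : ∫ x, (fderiv ℝ η x e : ℂ) * u x = ∫ x, θ x * u x := by simp_rw [hθ]
    rw [h5, h1]
    have h6 : ∫ x, (η x : ℂ) * v x j = ∫ x, χ x * v x j := rfl
    rw [h6, h3, ← integral_neg]
    congr 1; ext k
    rw [hinv]
    simp [W]
    ring
  refine (iInf₂_le (v : E3 → EuclideanSpace ℂ (Fin 3)) hv).trans (le_of_eq ?_)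
  have n1 : ‖v‖ = ‖hW.toLp‖ := by
    have : 𝓕 v = hW.toLp := FourierTransform.fourier_fourierInv_eq _
    rw [← this, Lp.norm_fourier_eq]
  have n2 : eLpNorm v 2 volume = eLpNorm W 2 volume := by
    rw [← eLpNorm_congr_ae hW.coeFn_toLp]
    rw [Lp.norm_def, Lp.norm_def] at n1
    exact (ENNReal.toReal_eq_toReal_iff' (Lp.eLpNorm_ne_top _) (Lp.eLpNorm_ne_top _)).1 n1
  rw [n2]
  exact eLpNorm_congr_norm_ae (Filter.Eventually.of_forall hWn)

/-! ### The form factor and its potential on the Fourier side. -/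

/-- `ρ` as a complex valued Schwartz function. -/
noncomputable def rhoC (ρ : 𝓢(E3, ℝ)) : 𝓢(E3, ℂ) := ρ.postcompCLM Complex.ofRealCLM

/-- The Fourier transform of `ρ`. -/
noncomputable def rhoHat (ρ : 𝓢(E3, ℝ)) : 𝓢(E3, ℂ) := 𝓕 (rhoC ρ)

theorem rhoC_apply (ρ : 𝓢(E3, ℝ)) (x : E3) : rhoC ρ x = (ρ x : ℂ) := by simp [rhoC]

/-- Composition of a Schwartz function with a dilation. -/
noncomputable def dilate (f : 𝓢(E3, ℂ)) {c : ℝ} (hc : c ≠ 0) : 𝓢(E3, ℂ) :=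
  SchwartzMap.compCLMOfContinuousLinearEquiv ℂ
    (ContinuousLinearEquiv.smulLeft (Units.mk0 c hc) : E3 ≃L[ℝ] E3) f

theorem dilate_apply (f : 𝓢(E3, ℂ)) {c : ℝ} (hc : c ≠ 0) (x : E3) :
    dilate f hc x = f (c • x) := rfl

/-- `ρ^ε` as a complex valued Schwartz function. -/
noncomputable def rhoS (ρ : 𝓢(E3, ℝ)) {ε : ℝ} (hε : 0 < ε) : 𝓢(E3, ℂ) :=
  (((ε ^ 3)⁻¹ : ℝ) : ℂ) • dilate (rhoC ρ) (inv_pos.2 hε).ne'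

theorem rhoS_apply (ρ : 𝓢(E3, ℝ)) {ε : ℝ} (hε : 0 < ε) (x : E3) :
    rhoS ρ hε x = (rhoEps ρ ε x : ℂ) := by
  simp [rhoS, dilate_apply, rhoC_apply, rhoEps]

theorem fourier_rhoS (ρ : 𝓢(E3, ℝ)) {ε : ℝ} (hε : 0 < ε) (k : E3) :
    (𝓕 (rhoS ρ hε) : 𝓢(E3, ℂ)) k = rhoHat ρ (ε • k) := by
  rw [rhoHat, SchwartzMap.fourier_coe, SchwartzMap.fourier_coe, Real.fourier_eq', Real.fourier_eq']
  have h := Measure.integral_comp_inv_smul (volume : Measure E3)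
    (fun v => Complex.exp (↑(-2 * Real.pi * inner ℝ v (ε • k)) * Complex.I) • rhoC ρ v) ε
  rw [finrank_euclideanSpace, Fintype.card_fin, abs_of_pos (by positivity)] at h
  have h2 : ∀ v : E3, Complex.exp (↑(-2 * Real.pi * inner ℝ v k) * Complex.I) • rhoS ρ hε v =
      ((ε ^ 3)⁻¹ : ℝ) • (Complex.exp (↑(-2 * Real.pi * inner ℝ (ε⁻¹ • v) (ε • k)) * Complex.I) •
        rhoC ρ (ε⁻¹ • v)) := by
    intro v
    have : inner ℝ (ε⁻¹ • v) (ε • k) = inner ℝ v k := by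
      rw [real_inner_smul_left, real_inner_smul_right]
      field_simp
    rw [this, rhoS]
    simp [dilate_apply]
    ring
  simp_rw [h2]
  rw [integral_smul, h, smul_smul, inv_mul_cancel₀ (by positivity), one_smul]

theorem rhoEpsL2_eq (ρ : 𝓢(E3, ℝ)) {ε : ℝ} (hε : 0 < ε) : rhoEpsL2 ρ ε = (rhoS ρ hε).toLp 2 := by
  apply Lp.ext
  filter_upwards [(memLp_rhoEps ρ ε).coeFn_toLp, (rhoS ρ hε).coeFn_toLp 2] with x h1 h2
  rw [rhoEpsL2, h1, h2, rhoS_apply]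

theorem fourier_rhoEpsL2 (ρ : 𝓢(E3, ℝ)) {ε : ℝ} (hε : 0 < ε) :
    (𝓕 (rhoEpsL2 ρ ε) : L2) =ᵐ[volume] fun k => rhoHat ρ (ε • k) := by
  rw [rhoEpsL2_eq ρ hε, SchwartzMap.toLp_fourier_eq]
  filter_upwards [(𝓕 (rhoS ρ hε)).coeFn_toLp 2] with k hk
  rw [hk, fourier_rhoS]

theorem integrable_rhoHat_mul_invKinetic (ρ : 𝓢(E3, ℝ)) {ε : ℝ} (hε : 0 < ε) :
    Integrable (fun k => rhoHat ρ (ε • k) * (invKinetic k : ℂ)) := by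
  have := integrable_schwartz_mul_invKinetic (𝓕 (rhoS ρ hε))
  simpa only [fourier_rhoS] using this

/-- At a fixed `x` the convolution is the pairing of `G` with the Schwartz function `y ↦ ρ^ε(x -
y)`, so the transform of `G` applies. The identity holds at every `x`, not only almost everywhere.
-/
theorem rhoConvG_eq (ρ : 𝓢(E3, ℝ)) {ε : ℝ} (hε : 0 < ε) (x : E3) :
    (rhoConvG ρ ε x : ℂ) = 𝓕⁻ (fun k => rhoHat ρ (ε • k) * (invKinetic k : ℂ)) x := by
  let η : 𝓢(E3, ℂ) := SchwartzMap.compSubConstCLM ℂ x (dilate (rhoS ρ hε) (c := -1) (by norm_num))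
  have hη : ∀ y, η y = (rhoEps ρ ε (x - y) : ℂ) := by
    intro y
    simp only [η, SchwartzMap.compSubConstCLM_apply, dilate_apply, rhoS_apply]
    congr 2
    simp
  have hinv : ∀ k, (𝓕⁻ η : 𝓢(E3, ℂ)) k =
      Complex.exp (↑(2 * Real.pi * inner ℝ k x) * Complex.I) * rhoHat ρ (ε • k) := by
    intro k
    rw [SchwartzMap.fourierInv_coe, Real.fourierInv_eq', ← fourier_rhoS ρ hε,
      SchwartzMap.fourier_coe, Real.fourier_eq', ← integral_const_mul]
    rw [← integral_sub_left_eq_self _ volume x]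
    congr 1; ext y
    rw [hη, rhoS_apply, sub_sub_cancel, smul_eq_mul, smul_eq_mul, ← mul_assoc, ← Complex.exp_add,
      inner_sub_left, real_inner_comm x k]
    congr 2
    push_cast
    ring
  have h := (hasFourier_G (𝓕⁻ η)).2.2
  rw [FourierTransform.fourier_fourierInv_eq] at h
  have e : (rhoConvG ρ ε x : ℂ) = ∫ y, η y * (G y : ℂ) := by
    rw [rhoConvG, ← integral_complex_ofReal]
    congr 1; ext y
    rw [hη]; push_cast; rfl
  rw [e, h, Real.fourierInv_eq']
  congr 1; ext k
  rw [hinv, smul_eq_mul, mul_assoc]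

/-- The multiplication formula `∫ f̂ g = ∫ f ĝ`, after the reflection `x ↦ -x` that exchanges the
forward and inverse transforms. -/
theorem hasFourier_of_eq_fourierInv {u m : E3 → ℂ} (hm : Integrable m) (hu : u = 𝓕⁻ m) :
    HasFourier u m := by
  have hF : Continuous (𝓕 m) := VectorFourier.fourierIntegral_continuous
    Real.continuous_fourierChar (L := innerₗ E3) continuous_inner hm
  have huF : ∀ x, u x = 𝓕 m (-x) := fun x => by rw [hu, Real.fourierInv_eq_fourier_neg]
  have hub : ∀ x, ‖u x‖ ≤ ∫ k, ‖m k‖ := fun x => by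
    rw [huF]; exact VectorFourier.norm_fourierIntegral_le_integral_norm _ _ _ _ _
  have huc : Continuous u := by
    rw [funext huF]; exact hF.comp continuous_neg
  intro η
  refine ⟨?_, ?_, ?_⟩
  · exact η.integrable.mul_bdd huc.aestronglyMeasurable (Filter.Eventually.of_forall hub)
  · obtain ⟨C, _, hC⟩ := exists_norm_pow_mul_le η 0
    refine hm.bdd_mul (c := C) η.continuous.aestronglyMeasurable
      (Filter.Eventually.of_forall fun k => ?_)
    simpa using hC k
  · have h := integral_fourier_mul_eq_of_integrable hm (𝓕⁻ η : 𝓢(E3, ℂ)).integrable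
    have h2 := integral_neg_eq_self (fun x => (𝓕 η : 𝓢(E3, ℂ)) x * u x) volume
    rw [← h2]
    have e1 : ∀ x, (𝓕 η : 𝓢(E3, ℂ)) (-x) * u (-x) = 𝓕 m x * (𝓕⁻ η : 𝓢(E3, ℂ)) x := by
      intro x
      rw [huF, neg_neg, SchwartzMap.fourierInv_coe, Real.fourierInv_eq_fourier_neg,
        SchwartzMap.fourier_coe, mul_comm]
    simp_rw [e1]
    rw [h]
    have e2 : 𝓕 (⇑(𝓕⁻ η : 𝓢(E3, ℂ))) = η := by
      rw [← SchwartzMap.fourier_coe, FourierTransform.fourier_fourierInv_eq]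
    rw [e2]
    congr 1; ext k; ring

theorem hasFourier_rhoConvG (ρ : 𝓢(E3, ℝ)) {ε : ℝ} (hε : 0 < ε) :
    HasFourier (fun x => (rhoConvG ρ ε x : ℂ))
      (fun k => rhoHat ρ (ε • k) * (invKinetic k : ℂ)) :=
  hasFourier_of_eq_fourierInv (integrable_rhoHat_mul_invKinetic ρ hε)
    (funext fun x => rhoConvG_eq ρ hε x)

theorem fourierInv_rhoC (ρ : 𝓢(E3, ℝ)) (k : E3) :
    (𝓕⁻ (rhoC ρ) : 𝓢(E3, ℂ)) k = starRingEnd ℂ (rhoHat ρ k) := by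
  rw [rhoHat, SchwartzMap.fourierInv_coe, SchwartzMap.fourier_coe, Real.fourierInv_eq',
    Real.fourier_eq', ← integral_conj]
  congr 1; ext v
  simp only [smul_eq_mul, map_mul, rhoC_apply, Complex.conj_ofReal, ← Complex.exp_conj,
    Complex.conj_I]
  congr 2
  push_cast
  ring

/-- Pair `ρ * G` with `ρ` itself; since `ρ` is real, its inverse transform is the conjugate of `ρ̂`,
and the product becomes `|ρ̂|²`. -/
theorem ell_eq (ρ : 𝓢(E3, ℝ)) : ell ρ = ∫ k, ‖rhoHat ρ k‖ ^ 2 * invKinetic k := by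
  have h := (hasFourier_rhoConvG ρ one_pos (𝓕⁻ (rhoC ρ))).2.2
  rw [FourierTransform.fourier_fourierInv_eq] at h
  have e1 : ∫ x, rhoC ρ x * (rhoConvG ρ 1 x : ℂ) = (ell ρ : ℂ) := by
    rw [ell, ← integral_complex_ofReal]
    congr 1; ext x
    simp [rhoC_apply, rhoConvG, rhoEps]
  rw [e1] at h
  have e2 : ∀ k, (𝓕⁻ (rhoC ρ) : 𝓢(E3, ℂ)) k * (rhoHat ρ ((1 : ℝ) • k) * (invKinetic k : ℂ)) =
      ((‖rhoHat ρ k‖ ^ 2 * invKinetic k : ℝ) : ℂ) := by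
    intro k
    rw [fourierInv_rhoC, one_smul, ← mul_assoc, Complex.conj_mul']
    push_cast; rfl
  simp_rw [e2] at h
  rw [integral_complex_ofReal] at h
  exact_mod_cast h

theorem invKinetic_nonneg (k : E3) : 0 ≤ invKinetic k := by unfold invKinetic; positivity

theorem invKinetic_smul (ε : ℝ) (k : E3) : invKinetic (ε • k) = (ε ^ 2)⁻¹ * invKinetic k := by
  rw [invKinetic, invKinetic, norm_smul, ← mul_inv, Real.norm_eq_abs]
  congr 1
  rw [mul_left_comm, mul_pow, sq_abs]

theorem measurable_invKinetic : Measurable invKinetic := by unfold invKinetic; fun_prop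

theorem integrable_rhoHat_sq_mul_invKinetic (ρ : 𝓢(E3, ℝ)) {ε : ℝ} (hε : 0 < ε) :
    Integrable (fun k => ‖rhoHat ρ (ε • k)‖ ^ 2 * invKinetic k) := by
  obtain ⟨C, _, hC⟩ := exists_norm_pow_mul_le (rhoHat ρ) 0
  have := (integrable_rhoHat_mul_invKinetic ρ hε).norm.const_mul C
  refine this.mono' ?_ (Filter.Eventually.of_forall fun k => ?_)
  · have hc : Continuous fun k : E3 => ‖rhoHat ρ (ε • k)‖ ^ 2 := by
      have := (rhoHat ρ).continuous
      fun_prop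
    exact hc.aestronglyMeasurable.mul measurable_invKinetic.aestronglyMeasurable
  · have h1 := hC (ε • k)
    rw [pow_zero, one_mul] at h1
    have h0 := invKinetic_nonneg k
    rw [norm_mul, norm_mul, Complex.norm_real, norm_pow, norm_norm, Real.norm_of_nonneg h0, sq,
      mul_assoc]
    gcongr

/-- The dilation contributes `ε⁻³` and the homogeneity of `|k|⁻²` contributes `ε²`. This is the
value of `(ρ^ε, G * ρ^ε)` that makes `charge` the projection coefficient. -/
theorem integral_rhoHat_sq_mul_invKinetic (ρ : 𝓢(E3, ℝ)) {ε : ℝ} (hε : 0 < ε) :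
    ∫ k, ‖rhoHat ρ (ε • k)‖ ^ 2 * invKinetic k = ell ρ / ε := by
  have h := Measure.integral_comp_smul (volume : Measure E3)
    (fun k => ‖rhoHat ρ k‖ ^ 2 * invKinetic k) ε
  rw [finrank_euclideanSpace, Fintype.card_fin, abs_of_pos (by positivity), ← ell_eq] at h
  have e : ∀ k, ‖rhoHat ρ (ε • k)‖ ^ 2 * invKinetic k =
      ε ^ 2 * (‖rhoHat ρ (ε • k)‖ ^ 2 * invKinetic (ε • k)) := by
    intro k
    rw [invKinetic_smul]
    field_simp
  simp_rw [e]
  rw [integral_const_mul, h, smul_eq_mul]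
  field_simp

theorem norm_rhoHat_le (ρ : 𝓢(E3, ℝ)) (hρ0 : ∀ x, 0 ≤ ρ x) (hρ : ∫ x, ρ x = 1) (k : E3) :
    ‖rhoHat ρ k‖ ≤ 1 := by
  rw [rhoHat, SchwartzMap.fourier_coe]
  refine (VectorFourier.norm_fourierIntegral_le_integral_norm _ _ _ _ _).trans ?_
  simp [rhoC_apply, abs_of_nonneg (hρ0 _), hρ]

/-- The total mass gives `ρ̂(0) = 1`, and the finite first moment of `ρ` gives the Lipschitz bound
there. -/
theorem exists_norm_rhoHat_sub_one_le (ρ : 𝓢(E3, ℝ)) (hρ : ∫ x, ρ x = 1) :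
    ∃ L : ℝ, 0 < L ∧ ∀ k, ‖rhoHat ρ k - 1‖ ≤ L * ‖k‖ := by
  have hint : Integrable fun x : E3 => ‖x‖ * ‖rhoC ρ x‖ := by
    simpa using (rhoC ρ).integrable_pow_mul volume 1
  refine ⟨2 * Real.pi * (∫ x : E3, ‖x‖ * ‖rhoC ρ x‖) + 1, by positivity, fun k => ?_⟩
  have h1 : (1 : ℂ) = ∫ x, rhoC ρ x := by
    simp [rhoC_apply, integral_complex_ofReal, hρ]
  have h2 : rhoHat ρ k - 1 = ∫ x, (Complex.exp (Complex.I * ↑(-2 * Real.pi * inner ℝ x k)) - 1) *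
      rhoC ρ x := by
    have hi : Integrable fun x => Complex.exp (Complex.I * ↑(-2 * Real.pi * inner ℝ x k)) *
        rhoC ρ x := by
      refine (rhoC ρ).integrable.bdd_mul (c := 1) ?_ (Filter.Eventually.of_forall fun x => ?_)
      · exact (by fun_prop : Continuous fun x : E3 =>
          Complex.exp (Complex.I * ↑(-2 * Real.pi * inner ℝ x k))).aestronglyMeasurable
      · rw [mul_comm, Complex.norm_exp_ofReal_mul_I]
    simp_rw [sub_mul, one_mul]
    rw [integral_sub hi (rhoC ρ).integrable, ← h1, rhoHat, SchwartzMap.fourier_coe,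
      Real.fourier_eq']
    simp_rw [mul_comm Complex.I, smul_eq_mul]
  rw [h2]
  refine (norm_integral_le_integral_norm _).trans ?_
  have h3 : ∫ x, ‖(Complex.exp (Complex.I * ↑(-2 * Real.pi * inner ℝ x k)) - 1) * rhoC ρ x‖ ≤
      ∫ x, (2 * Real.pi * ‖k‖) * (‖x‖ * ‖rhoC ρ x‖) := by
    refine integral_mono_of_nonneg (Filter.Eventually.of_forall fun x => norm_nonneg _)
      (hint.const_mul _) (Filter.Eventually.of_forall fun x => ?_)
    simp only [norm_mul]
    rw [← mul_assoc]
    gcongr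
    refine (Real.norm_exp_I_mul_ofReal_sub_one_le).trans ?_
    rw [norm_mul, norm_mul, norm_neg, Real.norm_ofNat, Real.norm_of_nonneg Real.pi_pos.le]
    have := norm_inner_le_norm (𝕜 := ℝ) x k
    calc 2 * Real.pi * ‖inner ℝ x k‖ ≤ 2 * Real.pi * (‖x‖ * ‖k‖) := by gcongr
      _ = _ := by ring
  refine h3.trans ?_
  rw [integral_const_mul]
  nlinarith [norm_nonneg k]

/-- The integrand of `ell_eq` is nonnegative, and it is positive on a punctured ball because `ρ̂` is
close to `1` there. -/
theorem ell_pos (ρ : 𝓢(E3, ℝ)) (hρ : ∫ x, ρ x = 1) : 0 < ell ρ := by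
  obtain ⟨L, hL, hLk⟩ := exists_norm_rhoHat_sub_one_le ρ hρ
  rw [ell_eq]
  have hnn : ∀ k, 0 ≤ ‖rhoHat ρ k‖ ^ 2 * invKinetic k := fun k =>
    mul_nonneg (by positivity) (invKinetic_nonneg k)
  have hi := integrable_rhoHat_sq_mul_invKinetic ρ one_pos
  simp only [one_smul] at hi
  rw [integral_pos_iff_support_of_nonneg hnn hi]
  have hsub : Metric.ball (0 : E3) L⁻¹ \ {0} ⊆
      Function.support fun k => ‖rhoHat ρ k‖ ^ 2 * invKinetic k := by
    intro k hk
    have hk0 : k ≠ 0 := hk.2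
    have hkL : ‖k‖ < L⁻¹ := by simpa using hk.1
    have h1 : rhoHat ρ k ≠ 0 := by
      intro h0
      have := hLk k
      rw [h0, zero_sub, norm_neg, norm_one] at this
      have h2 : L * ‖k‖ < L * L⁻¹ := by gcongr
      rw [mul_inv_cancel₀ hL.ne'] at h2
      linarith
    have h3 : invKinetic k ≠ 0 := by
      unfold invKinetic
      have := norm_pos_iff.2 hk0
      positivity
    simp only [Function.mem_support]
    exact mul_ne_zero (pow_ne_zero 2 (norm_ne_zero_iff.2 h1)) h3
  refine lt_of_lt_of_le ?_ (measure_mono hsub)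
  rw [measure_sdiff_null (by simp)]
  exact Metric.measure_ball_pos _ _ (by positivity)

theorem pairing_eq (ρ : 𝓢(E3, ℝ)) {ε : ℝ} (hε : 0 < ε) (ψ : L2) :
    pairing ρ ε ψ = ∫ k, starRingEnd ℂ (rhoHat ρ (ε • k)) * (𝓕 ψ : L2) k := by
  have h := Lp.inner_fourier_eq (rhoEpsL2 ρ ε) ψ
  rw [L2.inner_def, L2.inner_def] at h
  have e1 : ∫ x, inner ℂ (rhoEpsL2 ρ ε x) (ψ x) = pairing ρ ε ψ := by
    refine integral_congr_ae ?_
    filter_upwards [(memLp_rhoEps ρ ε).coeFn_toLp] with x hx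
    rw [rhoEpsL2, hx]
    simp [mul_comm]
  rw [← e1, ← h]
  refine integral_congr_ae ?_
  filter_upwards [fourier_rhoEpsL2 ρ hε] with k hk
  rw [hk]
  simp [mul_comm]

/-! ### The free evolution and Duhamel's formula at each wave vector. -/

theorem freeSymbol_eq (t : ℝ) (k : E3) :
    freeSymbol t k = Complex.exp (Complex.I * (-((2 * Real.pi * ‖k‖) ^ 2 * t) : ℝ)) := by
  rw [freeSymbol]; push_cast; ring_nf

theorem norm_freeSymbol (t : ℝ) (k : E3) : ‖freeSymbol t k‖ = 1 := by
  rw [freeSymbol_eq, mul_comm]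
  exact Complex.norm_exp_ofReal_mul_I _

theorem freeSymbol_add (s t : ℝ) (k : E3) :
    freeSymbol (s + t) k = freeSymbol s k * freeSymbol t k := by
  rw [freeSymbol_eq, freeSymbol_eq, freeSymbol_eq, ← Complex.exp_add]
  congr 1; push_cast; ring

theorem conj_freeSymbol (t : ℝ) (k : E3) : starRingEnd ℂ (freeSymbol t k) = freeSymbol (-t) k := by
  rw [freeSymbol_eq, freeSymbol_eq, ← Complex.exp_conj, map_mul, Complex.conj_I,
    Complex.conj_ofReal]
  congr 1
  push_cast; ring

theorem freeSymbol_zero (k : E3) : freeSymbol 0 k = 1 := by simp [freeSymbol]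

theorem continuous_freeSymbol : Continuous fun p : ℝ × E3 => freeSymbol p.1 p.2 := by
  unfold freeSymbol; fun_prop

theorem norm_freeSymbol_sub_le (s t : ℝ) (k : E3) :
    ‖freeSymbol s k - freeSymbol t k‖ ≤ |s - t| * (2 * Real.pi * ‖k‖) ^ 2 := by
  have h : freeSymbol s k - freeSymbol t k = freeSymbol t k * (freeSymbol (s - t) k - 1) := by
    rw [mul_sub, ← freeSymbol_add, add_sub_cancel, mul_one]
  rw [h, norm_mul, norm_freeSymbol, one_mul, freeSymbol_eq]
  refine Real.norm_exp_I_mul_ofReal_sub_one_le.trans (le_of_eq ?_)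
  rw [norm_neg, norm_mul, Real.norm_of_nonneg (by positivity), Real.norm_eq_abs, mul_comm]

theorem fourier_L2_sub (f g : L2) : (𝓕 (f - g) : L2) = 𝓕 f - 𝓕 g :=
  (Lp.fourierTransformₗᵢ E3 ℂ).map_sub f g

theorem fourier_freeU (t : ℝ) (f : L2) : 𝓕 (freeU t f) = (memLp_freeSymbol_mul t (𝓕 f)).toLp :=
  FourierTransform.fourier_fourierInv_eq _

theorem fourier_freeU_ae (t : ℝ) (f : L2) :
    (𝓕 (freeU t f) : L2) =ᵐ[volume] fun k => freeSymbol t k * (𝓕 f : L2) k := by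
  rw [fourier_freeU]
  exact MemLp.coeFn_toLp _

theorem memLp_kinetic_mul_schwartz (η : 𝓢(E3, ℂ)) :
    MemLp (fun k : E3 => (((2 * Real.pi * ‖k‖) ^ 2 : ℝ) : ℂ) * η k) 2 := by
  have h : (fun x : E3 => ‖x‖ ^ 2).HasTemperateGrowth := by fun_prop
  have h2 := ((SchwartzMap.smulLeftCLM ℂ (fun x : E3 => ‖x‖ ^ 2) η).memLp 2).const_mul
    (((2 * Real.pi) ^ 2 : ℝ) : ℂ)
  refine h2.ae_eq (Filter.Eventually.of_forall fun k => ?_)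
  simp only [SchwartzMap.smulLeftCLM_apply_apply h]
  rw [Complex.real_smul, mul_pow]
  push_cast; ring

/-- The free Schrödinger orbit of `ρ^ε` is Lipschitz continuous in `L²`. -/
theorem continuous_freeU_rhoEpsL2 (ρ : 𝓢(E3, ℝ)) {ε : ℝ} (hε : 0 < ε) :
    Continuous fun t => freeU t (rhoEpsL2 ρ ε) := by
  -- The phases at times `s` and `t` differ by at most `|s - t| (2π|k|)²`, so the `L²` norm of this
  -- function is a Lipschitz constant.
  have hm := memLp_kinetic_mul_schwartz (𝓕 (rhoS ρ hε))
  have key : ∀ s t, ‖freeU s (rhoEpsL2 ρ ε) - freeU t (rhoEpsL2 ρ ε)‖ ≤ |s - t| * ‖hm.toLp‖ := by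
    intro s t
    rw [← Lp.norm_fourier_eq, fourier_L2_sub]
    refine Lp.norm_le_mul_norm_of_ae_le_mul ?_
    filter_upwards [fourier_freeU_ae s (rhoEpsL2 ρ ε), fourier_freeU_ae t (rhoEpsL2 ρ ε),
      Lp.coeFn_sub (𝓕 (freeU s (rhoEpsL2 ρ ε))) (𝓕 (freeU t (rhoEpsL2 ρ ε))), hm.coeFn_toLp,
      fourier_rhoEpsL2 ρ hε] with k h1 h2 h3 h4 h5
    rw [h3, Pi.sub_apply, h1, h2, h4, h5, fourier_rhoS, ← sub_mul, norm_mul, norm_mul, ← mul_assoc,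
      Complex.norm_real, Real.norm_of_nonneg (by positivity)]
    gcongr
    exact norm_freeSymbol_sub_le s t k
  refine (LipschitzWith.of_dist_le_mul (K := ⟨‖hm.toLp‖, norm_nonneg _⟩) fun s t => ?_).continuous
  rw [dist_eq_norm, Real.dist_eq, mul_comm]
  exact key s t

/-- The Bochner integral of a continuous curve in `L²` may be computed pointwise. -/
theorem intervalIntegral_L2_ae {t : ℝ} (ht : 0 ≤ t) {F : ℝ → L2} (hF : ContinuousOn F (Icc 0 t))
    {p : ℝ → E3 → ℂ} (hp : Continuous (Function.uncurry p))
    (hFp : ∀ s ∈ Icc 0 t, F s =ᵐ[volume] p s) {b : E3 → ℝ} (hb : Continuous b)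
    (hpb : ∀ s ∈ Icc 0 t, ∀ k, ‖p s k‖ ≤ b k) :
    ((∫ s in (0 : ℝ)..t, F s : L2) : E3 → ℂ) =ᵐ[volume] fun k => ∫ s in (0 : ℝ)..t, p s k := by
  have hPc : Continuous fun k => ∫ s in (0 : ℝ)..t, p s k :=
    intervalIntegral.continuous_parametric_intervalIntegral_of_continuous'
      (f := fun k s => p s k) (hp.comp continuous_swap) 0 t
  -- Testing against a compactly supported `η` turns the Bochner integral into a scalar one by
  -- continuity of the inner product, and Fubini does the rest. The bound `b` need only be
  -- continuous, as it is integrated over the support of `η`.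
  refine ae_eq_of_integral_contDiff_smul_eq ((Lp.memLp _).locallyIntegrable (by norm_num))
    hPc.locallyIntegrable fun η hη hηc => ?_
  have hηm : MemLp (fun k => (η k : ℂ)) 2 :=
    Continuous.memLp_of_hasCompactSupport (by have := hη.continuous; fun_prop)
      (hηc.comp_left (g := ((↑) : ℝ → ℂ)) rfl)
  have hinner : ∀ f : L2, inner ℂ hηm.toLp f = ∫ k, η k • f k := by
    intro f
    rw [L2.inner_def]
    refine integral_congr_ae ?_
    filter_upwards [hηm.coeFn_toLp] with k hk
    rw [hk]
    simp [mul_comm]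
  rw [← hinner]
  have hii : IntervalIntegrable F volume 0 t := by
    refine ContinuousOn.intervalIntegrable ?_
    rwa [uIcc_of_le ht]
  have h1 := (innerSL ℂ hηm.toLp).intervalIntegral_comp_comm hii
  rw [innerSL_apply_apply] at h1
  rw [← h1]
  have h2 : ∫ s in (0 : ℝ)..t, (innerSL ℂ hηm.toLp) (F s) =
      ∫ s in (0 : ℝ)..t, ∫ k, η k • p s k := by
    refine intervalIntegral.integral_congr fun s hs => ?_
    rw [uIcc_of_le ht] at hs
    simp only [innerSL_apply_apply, hinner]
    refine integral_congr_ae ?_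
    filter_upwards [hFp s hs] with k hk
    rw [hk]
  rw [h2, intervalIntegral_integral_swap]
  · congr 1; ext k
    rw [← intervalIntegral.integral_smul]
  · have hηb : Integrable fun k => ‖η k‖ * b k :=
      (hη.continuous.norm.mul hb).integrable_of_hasCompactSupport (hηc.norm.mul_right)
    have hc : Integrable (fun _ : ℝ => (1 : ℝ)) (volume.restrict (uIoc 0 t)) := by
      simp [isFiniteMeasure_restrict]
    have hcont : Continuous (Function.uncurry fun (s : ℝ) (k : E3) => η k • p s k) := by
      have h3 : Continuous fun x : ℝ × E3 => η x.2 := hη.continuous.comp continuous_snd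
      exact h3.smul hp
    refine (hc.mul_prod hηb).mono' hcont.aestronglyMeasurable ?_
    rw [Measure.ae_prod_iff_ae_ae]
    · refine (ae_restrict_iff' measurableSet_uIoc).2 (Filter.Eventually.of_forall fun s hs => ?_)
      rw [uIoc_of_le ht] at hs
      refine Filter.Eventually.of_forall fun k => ?_
      simp only [Function.uncurry, norm_smul, one_mul]
      exact mul_le_mul_of_nonneg_left (hpb s ⟨hs.1.le, hs.2⟩ k) (norm_nonneg _)
    · exact measurableSet_le (by exact hcont.measurable.norm) (by
        have := hη.continuous
        exact (by fun_prop : Continuous fun z : ℝ × E3 => 1 * (‖η z.2‖ * b z.2)).measurable)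

theorem pairing_eq_inner (ρ : 𝓢(E3, ℝ)) (ε : ℝ) (ψ : L2) :
    pairing ρ ε ψ = inner ℂ (rhoEpsL2 ρ ε) ψ := by
  rw [L2.inner_def]
  refine integral_congr_ae ?_
  filter_upwards [(memLp_rhoEps ρ ε).coeFn_toLp] with x hx
  rw [rhoEpsL2, hx]
  simp [mul_comm]

/-- The strength of the source term `ρ^ε` in the scaled equation, extended continuously to all
times. -/
noncomputable def source (ρ : 𝓢(E3, ℝ)) (γ μ ε : ℝ) {T : ℝ} (hT : 0 ≤ T) (ψ : ℝ → L2) (t : ℝ) : ℂ :=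
  (coupling ρ γ μ ε (ψ (projIcc 0 T hT t)) : ℂ) * pairing ρ ε (ψ (projIcc 0 T hT t))

theorem source_of_mem (ρ : 𝓢(E3, ℝ)) (γ μ ε : ℝ) {T : ℝ} (hT : 0 ≤ T) (ψ : ℝ → L2) {t : ℝ}
    (ht : t ∈ Icc 0 T) :
    source ρ γ μ ε hT ψ t = (coupling ρ γ μ ε (ψ t) : ℂ) * pairing ρ ε (ψ t) := by
  rw [source, projIcc_of_mem hT ht]

theorem continuous_source (ρ : 𝓢(E3, ℝ)) (γ : ℝ) {μ : ℝ} (hμ : 0 ≤ μ) (ε : ℝ) {T : ℝ} (hT : 0 ≤ T)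
    {ψ : ℝ → L2} (hψ : ContinuousOn ψ (Icc 0 T)) : Continuous (source ρ γ μ ε hT ψ) := by
  have h1 : Continuous fun t => ψ (projIcc 0 T hT t) :=
    (continuousOn_iff_continuous_domRestrict.1 hψ).comp continuous_projIcc
  have h2 : Continuous fun t => pairing ρ ε (ψ (projIcc 0 T hT t)) := by
    simp_rw [pairing_eq_inner]
    exact continuous_const.inner h1
  have h3 : Continuous fun t => ‖pairing ρ ε (ψ (projIcc 0 T hT t))‖ ^ (2 * μ) :=
    h2.norm.rpow_const fun _ => Or.inr (by linarith)
  unfold source coupling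
  fun_prop

/-- The amplitude at the wave vector `k` in the interaction picture, for the initial datum `a₀` and
the source `f r`. -/
noncomputable def interactionAmp (a₀ r : E3 → ℂ) (f : ℝ → ℂ) (t : ℝ) (k : E3) : ℂ :=
  a₀ k - Complex.I * (r k * ∫ s in (0 : ℝ)..t, f s * freeSymbol (-s) k)

/-- Duhamel's formula at the wave vector `k`. -/
noncomputable def amp (a₀ r : E3 → ℂ) (f : ℝ → ℂ) (t : ℝ) (k : E3) : ℂ :=
  freeSymbol t k * interactionAmp a₀ r f t k

/-- The Fourier transform passes through the Bochner integral, which is then evaluated pointwise.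
The `L²` class at each time is thereby replaced by a function that is differentiable in `t` at every
`k`. -/
theorem IsScaledSolution.fourier_ae {ρ : 𝓢(E3, ℝ)} {γ μ ε T : ℝ} {ψ₀ : E3 → ℂ} {ψ : ℝ → L2}
    (hψ : IsScaledSolution ρ γ μ ε T ψ₀ ψ) (hε : 0 < ε) (hμ : 0 ≤ μ) (hT : 0 ≤ T) {t : ℝ}
    (ht : t ∈ Icc 0 T) :
    (𝓕 (ψ t) : L2) =ᵐ[volume] amp (𝓕 (ψ 0) : L2) (fun k => rhoHat ρ (ε • k))
      (source ρ γ μ ε hT ψ) t := by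
  set f := source ρ γ μ ε hT ψ with hf
  have hfc : Continuous f := continuous_source ρ γ hμ ε hT hψ.continuousOn
  set F : ℝ → L2 := fun s => f s • freeU (t - s) (rhoEpsL2 ρ ε) with hF
  have hFc : Continuous F :=
    hfc.smul ((continuous_freeU_rhoEpsL2 ρ hε).comp (continuous_const.sub continuous_id))
  have hd : ψ t = freeU t (ψ 0) - Complex.I • ∫ s in (0 : ℝ)..t, F s := by
    rw [hψ.duhamel t ht]
    congr 2
    refine intervalIntegral.integral_congr fun s hs => ?_
    rw [uIcc_of_le ht.1] at hs
    simp only [hF, hf]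
    rw [source_of_mem ρ γ μ ε hT ψ ⟨hs.1, hs.2.trans ht.2⟩]
  let L : L2 →L[ℂ] L2 := (Lp.fourierTransformₗᵢ E3 ℂ).toLinearIsometry.toContinuousLinearMap
  have hLF : 𝓕 (∫ s in (0 : ℝ)..t, F s) = ∫ s in (0 : ℝ)..t, (𝓕 (F s) : L2) :=
    (L.intervalIntegral_comp_comm (hFc.intervalIntegrable 0 t)).symm
  have hLc : Continuous fun s => (𝓕 (F s) : L2) := L.continuous.comp hFc
  let p : ℝ → E3 → ℂ := fun s k => f s * (freeSymbol (t - s) k * rhoHat ρ (ε • k))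
  have hr : Continuous fun k : E3 => rhoHat ρ (ε • k) :=
    (rhoHat ρ).continuous.comp (continuous_const_smul ε)
  have hp : Continuous (Function.uncurry p) := by
    have h1 : Continuous fun x : ℝ × E3 => freeSymbol (t - x.1) x.2 :=
      continuous_freeSymbol.comp (by fun_prop : Continuous fun x : ℝ × E3 => (t - x.1, x.2))
    have h2 : Continuous fun x : ℝ × E3 => f x.1 := hfc.comp continuous_fst
    exact h2.mul (h1.mul (hr.comp continuous_snd))
  have hpF : ∀ s ∈ Icc 0 t, (𝓕 (F s) : L2) =ᵐ[volume] p s := by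
    intro s _
    simp only [hF, FourierTransform.fourier_smul]
    filter_upwards [Lp.coeFn_smul (f s) (𝓕 (freeU (t - s) (rhoEpsL2 ρ ε)) : L2),
      fourier_freeU_ae (t - s) (rhoEpsL2 ρ ε), fourier_rhoEpsL2 ρ hε] with k h1 h2 h3
    rw [h1, Pi.smul_apply, h2, h3, smul_eq_mul]
  obtain ⟨M, hM⟩ := isCompact_Icc.exists_bound_of_continuousOn (s := Icc 0 t) hfc.continuousOn
  have hint := intervalIntegral_L2_ae ht.1 hLc.continuousOn hp hpF
    (b := fun k => M * ‖rhoHat ρ (ε • k)‖) (by fun_prop) (fun s hs k => by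
      simp only [p, norm_mul, norm_freeSymbol, one_mul]
      exact mul_le_mul_of_nonneg_right (hM s hs) (norm_nonneg _))
  have hdF : 𝓕 (ψ t) = 𝓕 (freeU t (ψ 0)) - Complex.I • ∫ s in (0 : ℝ)..t, (𝓕 (F s) : L2) := by
    rw [hd, fourier_L2_sub, FourierTransform.fourier_smul, hLF]
  rw [hdF]
  filter_upwards [Lp.coeFn_sub (𝓕 (freeU t (ψ 0)) : L2)
    (Complex.I • ∫ s in (0 : ℝ)..t, (𝓕 (F s) : L2)),
    Lp.coeFn_smul Complex.I (∫ s in (0 : ℝ)..t, (𝓕 (F s) : L2)), hint,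
    fourier_freeU_ae t (ψ 0)] with k h1 h2 h3 h4
  rw [h1, Pi.sub_apply, h2, Pi.smul_apply, h3, h4, amp, interactionAmp, mul_sub, smul_eq_mul]
  congr 1
  rw [mul_left_comm]
  congr 1
  rw [← intervalIntegral.integral_const_mul, ← intervalIntegral.integral_const_mul]
  refine intervalIntegral.integral_congr fun s _ => ?_
  simp only [p]
  rw [sub_eq_add_neg, freeSymbol_add]
  ring

/-! ### Mass and energy balance in Fourier variables. -/

/-- `(2π|k|)²`, the symbol of `-Δ`. -/
noncomputable def kinetic (k : E3) : ℝ := (2 * Real.pi * ‖k‖) ^ 2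

theorem kinetic_nonneg (k : E3) : 0 ≤ kinetic k := by unfold kinetic; positivity

theorem continuous_kinetic : Continuous kinetic := by unfold kinetic; fun_prop

section Amplitude

theorem norm_amp (a₀ r : E3 → ℂ) (f : ℝ → ℂ) (t : ℝ) (k : E3) :
    ‖amp a₀ r f t k‖ = ‖interactionAmp a₀ r f t k‖ := by
  rw [amp, norm_mul, norm_freeSymbol, one_mul]

theorem amp_zero (a₀ r : E3 → ℂ) (f : ℝ → ℂ) : amp a₀ r f 0 = a₀ := by
  ext k; simp [amp, interactionAmp, freeSymbol_zero]

variable {a₀ r : E3 → ℂ} {f : ℝ → ℂ}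

theorem continuous_mul_freeSymbol_neg (hf : Continuous f) :
    Continuous fun p : E3 × ℝ => f p.2 * freeSymbol (-p.2) p.1 := by
  have h2 : Continuous fun p : E3 × ℝ => freeSymbol (-p.2) p.1 := by
    unfold freeSymbol; fun_prop
  have h3 : Continuous fun p : E3 × ℝ => f p.2 := hf.comp continuous_snd
  exact h3.mul h2

theorem aestronglyMeasurable_amp (ha : AEStronglyMeasurable a₀) (hr : Continuous r)
    (hf : Continuous f) (t : ℝ) : AEStronglyMeasurable (amp a₀ r f t) := by
  have h1 : Continuous fun k => ∫ s in (0 : ℝ)..t, f s * freeSymbol (-s) k :=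
    intervalIntegral.continuous_parametric_intervalIntegral_of_continuous'
      (f := fun k s => f s * freeSymbol (-s) k) (continuous_mul_freeSymbol_neg hf) 0 t
  have h2 : Continuous fun k => freeSymbol t k := by unfold freeSymbol; fun_prop
  exact h2.aestronglyMeasurable.mul
    (ha.sub ((continuous_const.mul (hr.mul h1)).aestronglyMeasurable))

theorem hasDerivAt_interactionAmp (hf : Continuous f) (t : ℝ) (k : E3) :
    HasDerivAt (fun s => interactionAmp a₀ r f s k)
      (-(Complex.I * (r k * (f t * freeSymbol (-t) k)))) t := by
  have hc : Continuous fun s => f s * freeSymbol (-s) k :=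
    (continuous_mul_freeSymbol_neg hf).comp (Continuous.prodMk_right k)
  have h := intervalIntegral.integral_hasDerivAt_right (hc.intervalIntegrable 0 t)
    (hc.stronglyMeasurableAtFilter _ _) hc.continuousAt
  exact ((h.const_mul (r k)).const_mul Complex.I).const_sub (a₀ k)

theorem hasDerivAt_freeSymbol (t : ℝ) (k : E3) :
    HasDerivAt (fun s => freeSymbol s k) (-(Complex.I * (kinetic k * freeSymbol t k))) t := by
  have h1 : HasDerivAt (fun s : ℝ => -(Complex.I * ((kinetic k : ℂ) * (s : ℂ))))
      (-(Complex.I * ((kinetic k : ℂ) * 1))) t :=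
    ((((hasDerivAt_id t).ofReal_comp).const_mul (kinetic k : ℂ)).const_mul Complex.I).neg
  have h2 := h1.cexp
  have e : ∀ s, freeSymbol s k = Complex.exp (-(Complex.I * ((kinetic k : ℂ) * (s : ℂ)))) := by
    intro s; rw [freeSymbol, kinetic]; push_cast; rfl
  simp_rw [e]
  refine h2.congr_deriv ?_
  ring

theorem hasDerivAt_amp (hf : Continuous f) (t : ℝ) (k : E3) :
    HasDerivAt (fun s => amp a₀ r f s k)
      (-(Complex.I * (kinetic k * amp a₀ r f t k)) - Complex.I * (f t * r k)) t := by
  have h := (hasDerivAt_freeSymbol t k).mul (hasDerivAt_interactionAmp (a₀ := a₀) (r := r) hf t k)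
  refine h.congr_deriv (Eq.symm ?_)
  have h1 : freeSymbol t k * freeSymbol (-t) k = 1 := by
    rw [← freeSymbol_add, add_neg_cancel, freeSymbol_zero]
  simp only [amp]
  linear_combination Complex.I * f t * r k * h1

/-- The free phase drops out of the modulus, so only the source contributes. For this reason no
power of `kinetic` is lost when the mass and the kinetic energy are differentiated. -/
theorem hasDerivAt_norm_amp_sq (hf : Continuous f) (t : ℝ) (k : E3) :
    HasDerivAt (fun s => ‖amp a₀ r f s k‖ ^ 2)
      (2 * (f t * (starRingEnd ℂ (amp a₀ r f t k) * r k)).im) t := by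
  simp_rw [norm_amp]
  refine (hasDerivAt_interactionAmp (a₀ := a₀) (r := r) hf t k).norm_sq.congr_deriv (Eq.symm ?_)
  rw [Complex.inner, amp, map_mul, conj_freeSymbol]
  congr 1
  rw [show -(Complex.I * (r k * (f t * freeSymbol (-t) k))) *
    starRingEnd ℂ (interactionAmp a₀ r f t k) =
      -(Complex.I * (f t * (freeSymbol (-t) k * starRingEnd ℂ (interactionAmp a₀ r f t k) * r k)))
    by ring, Complex.neg_re, Complex.I_mul_re, neg_neg]

/-- Supplies the dominating functions for differentiation under the integral: `B` is uniform in `s`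
near `t`, in `k` and in the data. The factor `|t| + 1` is at least one, so the same `B` bounds both
`f` and its time integral. -/
theorem exists_amp_bound (hf : Continuous f) (t : ℝ) :
    ∃ B : ℝ, 0 ≤ B ∧ ∀ s ∈ Metric.ball t 1, ‖f s‖ ≤ B ∧
      ∀ (a₀ r : E3 → ℂ) (k : E3), ‖amp a₀ r f s k‖ ≤ ‖a₀ k‖ + B * ‖r k‖ := by
  obtain ⟨M, hM⟩ := (isCompact_Icc (a := -(|t| + 1)) (b := |t| + 1)).exists_bound_of_continuousOn
    hf.continuousOn
  have hM0 : 0 ≤ M := (norm_nonneg _).trans (hM 0 ⟨by linarith [abs_nonneg t],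
    by linarith [abs_nonneg t]⟩)
  refine ⟨M * (|t| + 1), by positivity, fun s hs => ?_⟩
  have hs' : |s| ≤ |t| + 1 := by
    rw [Metric.mem_ball, Real.dist_eq] at hs
    have := abs_sub_abs_le_abs_sub s t
    linarith
  have hfM : ∀ x, |x| ≤ |t| + 1 → ‖f x‖ ≤ M := fun x hx => hM x (abs_le.1 hx)
  refine ⟨(hfM s hs').trans ?_, fun a₀ r k => ?_⟩
  · nlinarith [abs_nonneg t]
  · rw [norm_amp, interactionAmp]
    refine (norm_sub_le _ _).trans ?_
    rw [norm_mul, norm_mul, Complex.norm_I, one_mul, mul_comm ‖r k‖]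
    have h1 : ‖∫ x in (0 : ℝ)..s, f x * freeSymbol (-x) k‖ ≤ M * |s - 0| := by
      refine intervalIntegral.norm_integral_le_of_norm_le_const fun x hx => ?_
      rw [norm_mul, norm_freeSymbol, mul_one]
      refine hfM x ((?_ : |x| ≤ |s|).trans hs')
      have := abs_sub_left_of_mem_uIcc (uIoc_subset_uIcc hx)
      simpa using this
    rw [sub_zero] at h1
    gcongr
    exact h1.trans (by gcongr)

variable {w : E3 → ℝ}

theorem integrable_weight_bound (hw : Measurable w) (hw0 : ∀ k, 0 ≤ w k)
    (ha : AEStronglyMeasurable a₀) (hr : Continuous r)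
    (h₁ : Integrable fun k => w k * ‖a₀ k‖ ^ 2) (h₂ : Integrable fun k => w k * ‖r k‖ ^ 2) (B : ℝ) :
    Integrable fun k => w k * ((‖a₀ k‖ + B * ‖r k‖) * ‖r k‖) := by
  have h3 : Integrable fun k => w k * (‖a₀ k‖ * ‖r k‖) := by
    refine (h₁.add h₂).mono' ?_ (Filter.Eventually.of_forall fun k => ?_)
    · exact hw.aestronglyMeasurable.mul (ha.norm.mul hr.norm.aestronglyMeasurable)
    · rw [Real.norm_of_nonneg (mul_nonneg (hw0 k) (by positivity)), Pi.add_apply, ← mul_add]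
      refine mul_le_mul_of_nonneg_left ?_ (hw0 k)
      nlinarith [sq_nonneg (‖a₀ k‖ - ‖r k‖), sq_nonneg (‖a₀ k‖ + ‖r k‖)]
  refine (h3.add (h₂.const_mul B)).congr (Filter.Eventually.of_forall fun k => ?_)
  simp only [Pi.add_apply]
  ring

theorem integrable_weight_mul_norm_amp_sq (hw : Measurable w) (hw0 : ∀ k, 0 ≤ w k)
    (ha : AEStronglyMeasurable a₀) (hr : Continuous r) (hf : Continuous f)
    (h₁ : Integrable fun k => w k * ‖a₀ k‖ ^ 2) (h₂ : Integrable fun k => w k * ‖r k‖ ^ 2)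
    (t : ℝ) : Integrable fun k => w k * ‖amp a₀ r f t k‖ ^ 2 := by
  obtain ⟨B, hB, h⟩ := exists_amp_bound hf t
  refine ((h₁.const_mul 2).add (h₂.const_mul (2 * B ^ 2))).mono'
    (hw.aestronglyMeasurable.mul ((aestronglyMeasurable_amp ha hr hf t).norm.pow 2))
    (Filter.Eventually.of_forall fun k => ?_)
  rw [Real.norm_of_nonneg (mul_nonneg (hw0 k) (by positivity)), Pi.add_apply]
  have h1 := (h t (Metric.mem_ball_self one_pos)).2 a₀ r k
  have h2 : ‖amp a₀ r f t k‖ ^ 2 ≤ 2 * ‖a₀ k‖ ^ 2 + 2 * B ^ 2 * ‖r k‖ ^ 2 := by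
    refine (pow_le_pow_left₀ (norm_nonneg _) h1 2).trans ?_
    nlinarith [sq_nonneg (‖a₀ k‖ - B * ‖r k‖)]
  calc _ ≤ w k * (2 * ‖a₀ k‖ ^ 2 + 2 * B ^ 2 * ‖r k‖ ^ 2) := by gcongr; exact hw0 k
    _ = _ := by ring

theorem hasDerivAt_integral_weight_mul_norm_amp_sq (hw : Measurable w) (hw0 : ∀ k, 0 ≤ w k)
    (ha : AEStronglyMeasurable a₀) (hr : Continuous r) (hf : Continuous f)
    (h₁ : Integrable fun k => w k * ‖a₀ k‖ ^ 2) (h₂ : Integrable fun k => w k * ‖r k‖ ^ 2)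
    (t : ℝ) :
    HasDerivAt (fun s => ∫ k, w k * ‖amp a₀ r f s k‖ ^ 2)
      (2 * (f t * ∫ k, (w k : ℂ) * (starRingEnd ℂ (amp a₀ r f t k) * r k)).im) t := by
  obtain ⟨B, hB, h⟩ := exists_amp_bound hf t
  have hm := fun s => aestronglyMeasurable_amp ha hr hf s
  have hbd := integrable_weight_bound hw hw0 ha hr h₁ h₂ B
  have hcm : AEStronglyMeasurable fun k => starRingEnd ℂ (amp a₀ r f t k) * r k :=
    (Complex.continuous_conj.comp_aestronglyMeasurable (hm t)).mul hr.aestronglyMeasurable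
  have hD := (hasDerivAt_integral_of_dominated_loc_of_deriv_le
    (F := fun s k => w k * ‖amp a₀ r f s k‖ ^ 2)
    (F' := fun s k => w k * (2 * (f s * (starRingEnd ℂ (amp a₀ r f s k) * r k)).im))
    (bound := fun k => 2 * B * (w k * ((‖a₀ k‖ + B * ‖r k‖) * ‖r k‖)))
    (Metric.ball_mem_nhds t one_pos)
    (Filter.Eventually.of_forall fun s => hw.aestronglyMeasurable.mul ((hm s).norm.pow 2))
    (integrable_weight_mul_norm_amp_sq hw hw0 ha hr hf h₁ h₂ t)
    (hw.aestronglyMeasurable.mul (aestronglyMeasurable_const.mul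
      (Complex.continuous_im.comp_aestronglyMeasurable (aestronglyMeasurable_const.mul hcm))))
    (Filter.Eventually.of_forall fun k s hs => ?_)
    (hbd.const_mul _)
    (Filter.Eventually.of_forall fun k s hs => (hasDerivAt_norm_amp_sq hf s k).const_mul (w k))).2
  · refine hD.congr_deriv (Eq.symm ?_)
    have hi : Integrable fun k => (w k : ℂ) * (starRingEnd ℂ (amp a₀ r f t k) * r k) := by
      refine hbd.mono' ((Complex.continuous_ofReal.comp_aestronglyMeasurable
        hw.aestronglyMeasurable).mul hcm) (Filter.Eventually.of_forall fun k => ?_)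
      rw [norm_mul, norm_mul, Complex.norm_real, RCLike.norm_conj, Real.norm_of_nonneg (hw0 k)]
      have h3 := (h t (Metric.mem_ball_self one_pos)).2 a₀ r k
      have := hw0 k
      gcongr
    rw [← integral_const_mul]
    have h4 := integral_im (hi.const_mul (f t))
    simp only [RCLike.im_to_complex] at h4
    rw [← h4, ← integral_const_mul]
    congr 1; ext k
    rw [show f t * ((w k : ℂ) * (starRingEnd ℂ (amp a₀ r f t k) * r k)) =
      (w k : ℂ) * (f t * (starRingEnd ℂ (amp a₀ r f t k) * r k)) by ring, Complex.im_ofReal_mul]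
    ring
  · have h3 := (h s hs).2 a₀ r k
    have h4 := (h s hs).1
    have hw' := hw0 k
    rw [norm_mul, Real.norm_of_nonneg hw', norm_mul, Real.norm_ofNat]
    have h5 : ‖(f s * (starRingEnd ℂ (amp a₀ r f s k) * r k)).im‖ ≤
        B * ((‖a₀ k‖ + B * ‖r k‖) * ‖r k‖) := by
      refine (Complex.abs_im_le_norm _).trans ?_
      rw [norm_mul, norm_mul, RCLike.norm_conj]
      gcongr
    calc _ ≤ w k * (2 * (B * ((‖a₀ k‖ + B * ‖r k‖) * ‖r k‖))) := by gcongr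
      _ = _ := by ring

/-- Finiteness of mass and kinetic energy of the initial datum and of the source profile. -/
structure FiniteEnergy (a : E3 → ℂ) : Prop where
  mass : Integrable fun k => ‖a k‖ ^ 2
  kinetic : Integrable fun k => kinetic k * ‖a k‖ ^ 2

/-- The phase of the amplitude matters here, so the derivative contains `kinetic`; it is dominated
because `kinetic · |a₀| |r|` is integrable when `a₀` and `r` both have finite kinetic energy. -/
theorem hasDerivAt_integral_conj_mul_amp
    (ha : AEStronglyMeasurable a₀) (hr : Continuous r) (hf : Continuous f)
    (h₁ : FiniteEnergy a₀) (h₂ : FiniteEnergy r) (t : ℝ) :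
    HasDerivAt (fun s => ∫ k, starRingEnd ℂ (r k) * amp a₀ r f s k)
      (-(Complex.I * starRingEnd ℂ
          (∫ k, (kinetic k : ℂ) * (starRingEnd ℂ (amp a₀ r f t k) * r k))) -
        Complex.I * (f t * ((∫ k, ‖r k‖ ^ 2 : ℝ) : ℂ))) t := by
  obtain ⟨B, hB, h⟩ := exists_amp_bound hf t
  have hm := fun s => aestronglyMeasurable_amp ha hr hf s
  have hrc : Continuous fun k => starRingEnd ℂ (r k) := Complex.continuous_conj.comp hr
  have hkc : Continuous fun k => (kinetic k : ℂ) :=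
    Complex.continuous_ofReal.comp continuous_kinetic
  have hb1 := integrable_weight_bound (w := fun _ => 1) measurable_const (fun _ => zero_le_one)
    ha hr (by simpa using h₁.mass) (by simpa using h₂.mass) B
  have hbk := integrable_weight_bound continuous_kinetic.measurable kinetic_nonneg
    ha hr h₁.kinetic h₂.kinetic B
  have hD := (hasDerivAt_integral_of_dominated_loc_of_deriv_le
    (F := fun s k => starRingEnd ℂ (r k) * amp a₀ r f s k)
    (F' := fun s k => starRingEnd ℂ (r k) * (-(Complex.I * (kinetic k * amp a₀ r f s k)) -
      Complex.I * (f s * r k)))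
    (bound := fun k => kinetic k * ((‖a₀ k‖ + B * ‖r k‖) * ‖r k‖) + B * ‖r k‖ ^ 2)
    (Metric.ball_mem_nhds t one_pos)
    (Filter.Eventually.of_forall fun s => hrc.aestronglyMeasurable.mul (hm s))
    (hb1.mono' (hrc.aestronglyMeasurable.mul (hm t)) (Filter.Eventually.of_forall fun k => ?_))
    (hrc.aestronglyMeasurable.mul
      ((aestronglyMeasurable_const.mul (hkc.aestronglyMeasurable.mul (hm t))).neg.sub
        (aestronglyMeasurable_const.mul (aestronglyMeasurable_const.mul hr.aestronglyMeasurable))))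
    (Filter.Eventually.of_forall fun k s hs => ?_)
    (hbk.add (h₂.mass.const_mul B))
    (Filter.Eventually.of_forall fun k s hs => (hasDerivAt_amp hf s k).const_mul _)).2
  · refine hD.congr_deriv (Eq.symm ?_)
    have hi : Integrable fun k => (kinetic k : ℂ) * (starRingEnd ℂ (amp a₀ r f t k) * r k) := by
      refine hbk.mono' (hkc.aestronglyMeasurable.mul
        ((Complex.continuous_conj.comp_aestronglyMeasurable (hm t)).mul hr.aestronglyMeasurable))
        (Filter.Eventually.of_forall fun k => ?_)
      rw [norm_mul, norm_mul, Complex.norm_real, RCLike.norm_conj,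
        Real.norm_of_nonneg (kinetic_nonneg k)]
      have h3 := (h t (Metric.mem_ball_self one_pos)).2 a₀ r k
      have := kinetic_nonneg k
      gcongr
    have hi' : Integrable fun k => starRingEnd ℂ ((kinetic k : ℂ) *
        (starRingEnd ℂ (amp a₀ r f t k) * r k)) := by
      refine hi.norm.mono' (Complex.continuous_conj.comp_aestronglyMeasurable
        hi.aestronglyMeasurable) (Filter.Eventually.of_forall fun k => ?_)
      rw [RCLike.norm_conj]
    have hrr : Integrable fun k => ((‖r k‖ ^ 2 : ℝ) : ℂ) := h₂.mass.ofReal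
    rw [← integral_conj, ← integral_complex_ofReal, ← integral_const_mul, ← integral_const_mul,
      ← integral_const_mul, ← integral_neg]
    refine (integral_sub (hi'.const_mul Complex.I).neg
      ((hrr.const_mul (f t)).const_mul Complex.I)).symm.trans ?_
    congr 1; ext k
    simp only [Pi.neg_apply]
    have e : ((‖r k‖ ^ 2 : ℝ) : ℂ) = starRingEnd ℂ (r k) * r k := by
      rw [Complex.conj_mul']; push_cast; rfl
    rw [e]
    simp only [map_mul, Complex.conj_ofReal, Complex.conj_conj]
    ring
  · have h3 := (h t (Metric.mem_ball_self one_pos)).2 a₀ r k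
    rw [norm_mul, RCLike.norm_conj, one_mul, mul_comm]
    gcongr
  · have h3 := (h s hs).2 a₀ r k
    have h4 := (h s hs).1
    have hk := kinetic_nonneg k
    rw [norm_mul, RCLike.norm_conj]
    have h5 : ‖-(Complex.I * (kinetic k * amp a₀ r f s k)) - Complex.I * (f s * r k)‖ ≤
        kinetic k * (‖a₀ k‖ + B * ‖r k‖) + B * ‖r k‖ := by
      refine (norm_sub_le _ _).trans ?_
      rw [norm_neg, norm_mul, norm_mul, norm_mul, norm_mul, Complex.norm_I, one_mul, one_mul,
        Complex.norm_real, Real.norm_of_nonneg hk]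
      gcongr
    calc _ ≤ ‖r k‖ * (kinetic k * (‖a₀ k‖ + B * ‖r k‖) + B * ‖r k‖) := by gcongr
      _ = _ := by ring

/-- Conservation of mass and energy for the Hamiltonian equation with a nonlinearity concentrated
on the profile `r`. -/
theorem mass_energy_conservation {T c b μ : ℝ} (hμ : 0 ≤ μ)
    (ha : AEStronglyMeasurable a₀) (hr : Continuous r) (hf : Continuous f)
    (h₁ : FiniteEnergy a₀) (h₂ : FiniteEnergy r) {z : ℝ → ℂ}
    (hz : z = fun s => ∫ k, starRingEnd ℂ (r k) * amp a₀ r f s k)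
    (hfz : ∀ t ∈ Icc 0 T, f t = ((-c + b * ‖z t‖ ^ (2 * μ) : ℝ) : ℂ) * z t) :
    ∀ t ∈ Icc 0 T, ∫ k, ‖amp a₀ r f t k‖ ^ 2 = ∫ k, ‖a₀ k‖ ^ 2 ∧
      (∫ k, kinetic k * ‖amp a₀ r f t k‖ ^ 2) - c * ‖z t‖ ^ 2 +
          b / (μ + 1) * (‖z t‖ ^ 2) ^ (μ + 1) =
        (∫ k, kinetic k * ‖a₀ k‖ ^ 2) - c * ‖z 0‖ ^ 2 +
          b / (μ + 1) * (‖z 0‖ ^ 2) ^ (μ + 1) := by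
  have hM := hasDerivAt_integral_weight_mul_norm_amp_sq (w := fun _ => 1) measurable_const
    (fun _ => zero_le_one) ha hr hf (by simpa using h₁.mass) (by simpa using h₂.mass)
  have hK := hasDerivAt_integral_weight_mul_norm_amp_sq continuous_kinetic.measurable
    kinetic_nonneg ha hr hf h₁.kinetic h₂.kinetic
  have hZ := hasDerivAt_integral_conj_mul_amp ha hr hf h₁ h₂
  rw [← hz] at hZ
  simp only [one_mul, Complex.ofReal_one] at hM
  have hconj : ∀ t, ∫ k, starRingEnd ℂ (amp a₀ r f t k) * r k = starRingEnd ℂ (z t) := by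
    intro t
    rw [hz, ← integral_conj]
    congr 1; ext k
    rw [map_mul, Complex.conj_conj, mul_comm]
  simp_rw [hconj] at hM
  have hzsq : ∀ t, HasDerivAt (fun s => ‖z s‖ ^ 2) (2 * inner ℝ (z t) _) t := fun t =>
    (hZ t).norm_sq
  -- Written as a power of `‖z‖²` with exponent at least one, the potential energy is differentiable
  -- even where `z` vanishes.
  have hpow : ∀ t, HasDerivAt (fun s => (‖z s‖ ^ 2) ^ (μ + 1)) _ t := fun t =>
    (hzsq t).rpow_const (p := μ + 1) (Or.inr (by linarith))
  have hE := fun t => ((hK t).sub ((hzsq t).const_mul c)).add ((hpow t).const_mul (b / (μ + 1)))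
  have hμ1 : μ + 1 ≠ 0 := by linarith
  intro t ht
  constructor
  · have := constant_of_has_deriv_right_zero (a := 0) (b := T)
      (f := fun s => ∫ k, ‖amp a₀ r f s k‖ ^ 2)
      (fun s _ => (hM s).continuousAt.continuousWithinAt) (fun s hs => ?_) t ht
    · simpa only [amp_zero] using this
    · refine ((hM s).congr_deriv ?_).hasDerivWithinAt
      -- Gauge invariance: `f` is a real multiple of `z`, so `f z̄` is real.
      rw [hfz s ⟨hs.1, hs.2.le⟩, mul_assoc, Complex.mul_conj, ← Complex.ofReal_mul,
        Complex.ofReal_im, mul_zero]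
  · have := constant_of_has_deriv_right_zero (a := 0) (b := T)
      (fun s _ => (hE s).continuousAt.continuousWithinAt) (fun s hs => ?_) t ht
    · simpa only [Pi.add_apply, Pi.sub_apply, amp_zero] using this
    · refine ((hE s).congr_deriv ?_).hasDerivWithinAt
      -- With `f = g z` and `g` real, the kinetic energy changes at rate `2g Im(zκ)` and `‖z‖²` at
      -- rate `-2 Im(zκ)`; the term in `‖r‖²` drops out because `f z̄` is real. The potential energy
      -- has derivative `g` with respect to `‖z‖²`, so the rates cancel.
      set κ := ∫ k, (kinetic k : ℂ) * (starRingEnd ℂ (amp a₀ r f s k) * r k) with hκ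
      have h1 : (‖z s‖ ^ 2) ^ (μ + 1 - 1) = ‖z s‖ ^ (2 * μ) := by
        rw [add_sub_cancel_right, Real.rpow_mul (norm_nonneg _), Real.rpow_two]
      rw [h1, hfz s ⟨hs.1, hs.2.le⟩, Complex.inner]
      simp only [Complex.mul_re, Complex.mul_im, Complex.sub_re, Complex.sub_im, Complex.neg_re,
        Complex.neg_im, Complex.I_re, Complex.I_im, Complex.conj_re, Complex.conj_im,
        Complex.ofReal_re, Complex.ofReal_im]
      field_simp
      ring

end Amplitude

/-! ### The orthogonal splitting and low-frequency control of the charge. -/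

theorem kinetic_mul_invKinetic {k : E3} (hk : k ≠ 0) : kinetic k * invKinetic k = 1 := by
  have := norm_pos_iff.2 hk
  rw [kinetic, invKinetic]
  exact mul_inv_cancel₀ (by positivity)

theorem ae_ne_zero : ∀ᵐ k : E3, k ≠ 0 := by simp [ae_iff]

section Splitting

variable {a r : E3 → ℂ}

/-- Cauchy–Schwarz between the dual weights `|k|²` and `|k|⁻²`; `a` itself need not be square
integrable, which allows its use for the transform of `φ₀`. -/
theorem integrable_conj_mul_of_kinetic (ha : AEStronglyMeasurable a) (hr : Continuous r)
    (hka : Integrable fun k => kinetic k * ‖a k‖ ^ 2)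
    (hir : Integrable fun k => ‖r k‖ ^ 2 * invKinetic k) :
    Integrable fun k => starRingEnd ℂ (r k) * a k := by
  refine (hka.add hir).mono'
    ((Complex.continuous_conj.comp hr).aestronglyMeasurable.mul ha) ?_
  filter_upwards [ae_ne_zero] with k hk
  rw [norm_mul, RCLike.norm_conj, Pi.add_apply]
  have h1 := kinetic_mul_invKinetic hk
  have h2 := kinetic_nonneg k
  have h3 := invKinetic_nonneg k
  have h4 : Real.sqrt (kinetic k) * Real.sqrt (invKinetic k) = 1 := by
    rw [← Real.sqrt_mul h2, h1, Real.sqrt_one]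
  have h5 := Real.sq_sqrt h2
  have h6 := Real.sq_sqrt h3
  have h7 : ‖r k‖ * ‖a k‖ =
      (Real.sqrt (kinetic k) * ‖a k‖) * (Real.sqrt (invKinetic k) * ‖r k‖) := by
    linear_combination (-‖r k‖ * ‖a k‖) * h4
  rw [h7, ← h5, ← h6, Real.sqrt_sq (Real.sqrt_nonneg _), Real.sqrt_sq (Real.sqrt_nonneg _)]
  nlinarith [sq_nonneg (Real.sqrt (kinetic k) * ‖a k‖ - Real.sqrt (invKinetic k) * ‖r k‖),
    sq_nonneg (Real.sqrt (kinetic k) * ‖a k‖ + Real.sqrt (invKinetic k) * ‖r k‖)]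

/-- Subtracting a multiple of `r (-Δ)⁻¹` is an orthogonal projection for the kinetic energy when
the multiple is `(r, a) / (r, (-Δ)⁻¹ r)`. -/
theorem integral_kinetic_sub (ha : AEStronglyMeasurable a) (hr : Continuous r)
    (hka : Integrable fun k => kinetic k * ‖a k‖ ^ 2)
    (hir : Integrable fun k => ‖r k‖ ^ 2 * invKinetic k) {Λ : ℝ}
    (hrΛ : ∫ k, ‖r k‖ ^ 2 * invKinetic k = Λ) {z : ℂ} (hz : ∫ k, starRingEnd ℂ (r k) * a k = z)
    {q : ℂ} (hq : q * (Λ : ℂ) = z) :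
    Integrable (fun k => kinetic k * ‖a k - q * (r k * (invKinetic k : ℂ))‖ ^ 2) ∧
      ∫ k, kinetic k * ‖a k - q * (r k * (invKinetic k : ℂ))‖ ^ 2 =
        (∫ k, kinetic k * ‖a k‖ ^ 2) - Λ * ‖q‖ ^ 2 := by
  have hi := (integrable_conj_mul_of_kinetic ha hr hka hir).const_mul (starRingEnd ℂ q)
  have hre : Integrable fun k => (starRingEnd ℂ q * (starRingEnd ℂ (r k) * a k)).re := hi.re
  have hpt : (fun k => kinetic k * ‖a k‖ ^ 2 -
      2 * (starRingEnd ℂ q * (starRingEnd ℂ (r k) * a k)).re +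
      ‖q‖ ^ 2 * (‖r k‖ ^ 2 * invKinetic k)) =ᵐ[volume]
      fun k => kinetic k * ‖a k - q * (r k * (invKinetic k : ℂ))‖ ^ 2 := by
    filter_upwards [ae_ne_zero] with k hk
    have h1 := kinetic_mul_invKinetic hk
    simp only [← Complex.normSq_eq_norm_sq, Complex.normSq_apply, Complex.sub_re, Complex.sub_im,
      Complex.mul_re, Complex.mul_im, Complex.conj_re, Complex.conj_im, Complex.ofReal_re,
      Complex.ofReal_im]
    generalize (a k).re = a1, (a k).im = a2, (r k).re = r1, (r k).im = r2, q.re = q1, q.im = q2,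
      kinetic k = K, invKinetic k = J at *
    linear_combination (2 * (q1 * (r1 * a1 + r2 * a2) + q2 * (r1 * a2 - r2 * a1)) -
      (q1 ^ 2 + q2 ^ 2) * (r1 ^ 2 + r2 ^ 2) * J) * h1
  have hint := (hka.sub (hre.const_mul 2)).add (hir.const_mul (‖q‖ ^ 2))
  refine ⟨hint.congr hpt, ?_⟩
  rw [← integral_congr_ae hpt]
  have e1 : ∫ k, (starRingEnd ℂ q * (starRingEnd ℂ (r k) * a k)).re = Λ * ‖q‖ ^ 2 := by
    have h := integral_re hi
    simp only [RCLike.re_to_complex] at h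
    rw [h, integral_const_mul, hz, ← hq, ← mul_assoc, Complex.conj_mul', ← Complex.ofReal_pow,
      ← Complex.ofReal_mul, Complex.ofReal_re, mul_comm]
  rw [integral_add (f := fun k => kinetic k * ‖a k‖ ^ 2 -
      2 * (starRingEnd ℂ q * (starRingEnd ℂ (r k) * a k)).re)
    (hka.sub (hre.const_mul 2)) (hir.const_mul (‖q‖ ^ 2)),
    integral_sub hka (hre.const_mul 2), integral_const_mul, integral_const_mul, e1, hrΛ]
  ring

/-- Low frequencies control the charge. -/
theorem charge_sq_le_of_ball {a r : E3 → ℂ} {q : ℂ} {R : ℝ} (hR : 0 < R)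
    (ha : Integrable fun k => ‖a k‖ ^ 2)
    (hφ : Integrable fun k => kinetic k * ‖a k - q * (r k * (invKinetic k : ℂ))‖ ^ 2)
    (hr : ∀ k : E3, ‖k‖ ≤ R → 1 / 2 ≤ ‖r k‖) :
    R ^ 3 * volume.real (Metric.ball (0 : E3) 1) * ‖q‖ ^ 2 ≤
      8 * (2 * Real.pi * R) ^ 4 * (∫ k, ‖a k‖ ^ 2) +
        8 * (2 * Real.pi * R) ^ 2 *
          ∫ k, kinetic k * ‖a k - q * (r k * (invKinetic k : ℂ))‖ ^ 2 := by
  have hvol : volume.real (Metric.ball (0 : E3) R) =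
      R ^ 3 * volume.real (Metric.ball (0 : E3) 1) := by
    rw [Measure.real, Measure.addHaar_ball_of_pos _ _ hR, ENNReal.toReal_mul,
      ENNReal.toReal_ofReal (by positivity), finrank_euclideanSpace, Fintype.card_fin, Measure.real]
  rw [← hvol, ← integral_const_mul, ← integral_const_mul,
    ← integral_add (ha.const_mul _) (hφ.const_mul _)]
  have h1 : volume.real (Metric.ball (0 : E3) R) * ‖q‖ ^ 2 =
      ∫ _ in Metric.ball (0 : E3) R, ‖q‖ ^ 2 := by
    rw [setIntegral_const, smul_eq_mul]
  rw [h1]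
  have hint := (ha.const_mul (8 * (2 * Real.pi * R) ^ 4)).add
    (hφ.const_mul (8 * (2 * Real.pi * R) ^ 2))
  refine le_trans ?_ (setIntegral_le_integral (s := Metric.ball (0 : E3) R) hint
    (Filter.Eventually.of_forall fun k => ?_))
  · refine setIntegral_mono_on_ae
      (integrableOn_const (by exact measure_ball_lt_top.ne)) hint.integrableOn
      Metric.isOpen_ball.measurableSet ?_
    filter_upwards [ae_ne_zero] with k hk hkR
    have hkR' : ‖k‖ ≤ R := by simpa using (Metric.mem_ball.1 hkR).le
    have hr' := hr k hkR'
    have hK1 := kinetic_mul_invKinetic hk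
    have hK0 := kinetic_nonneg k
    set X := a k - q * (r k * (invKinetic k : ℂ)) with hX
    have hKR : kinetic k ≤ (2 * Real.pi * R) ^ 2 := by
      rw [kinetic]
      gcongr
    -- Solve the splitting for `q` at one wave vector. The lower bound on `|r|` then makes every `k`
    -- in the ball an estimate for the same number `q`, and these are averaged.
    have hqr : q * r k = (kinetic k : ℂ) * (a k - X) := by
      rw [hX]
      have : (kinetic k : ℂ) * (invKinetic k : ℂ) = 1 := by exact_mod_cast hK1
      linear_combination (-q * r k) * this
    have h2 : ‖q‖ * ‖r k‖ ≤ kinetic k * (‖a k‖ + ‖X‖) := by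
      rw [← norm_mul, hqr, norm_mul, Complex.norm_real, Real.norm_of_nonneg hK0]
      gcongr
      exact norm_sub_le _ _
    have h3 : ‖q‖ ≤ 2 * (kinetic k * (‖a k‖ + ‖X‖)) := by
      nlinarith [norm_nonneg q]
    have h4 : ‖q‖ ^ 2 ≤ 8 * (kinetic k ^ 2 * ‖a k‖ ^ 2 + kinetic k * (kinetic k * ‖X‖ ^ 2)) := by
      refine (pow_le_pow_left₀ (norm_nonneg q) h3 2).trans ?_
      nlinarith [mul_nonneg (sq_nonneg (kinetic k)) (sq_nonneg (‖a k‖ - ‖X‖))]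
    refine h4.trans ?_
    have h5 : kinetic k ^ 2 ≤ (2 * Real.pi * R) ^ 4 := by
      calc kinetic k ^ 2 ≤ ((2 * Real.pi * R) ^ 2) ^ 2 := by gcongr
        _ = _ := by ring
    have h6 : 0 ≤ kinetic k * ‖X‖ ^ 2 := by positivity
    nlinarith [mul_le_mul_of_nonneg_right h5 (sq_nonneg (‖a k‖)),
      mul_le_mul_of_nonneg_right hKR h6]
  · have := kinetic_nonneg k
    simp only [Pi.zero_apply]
    positivity

end Splitting

/-! ### The charge estimate, uniform in `ε`, and absorption of subquadratic terms. -/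

theorem exists_half_le_norm_rhoHat (ρ : 𝓢(E3, ℝ)) (hρ : ∫ x, ρ x = 1) :
    ∃ δ : ℝ, 0 < δ ∧ ∀ k : E3, ‖k‖ ≤ δ → 1 / 2 ≤ ‖rhoHat ρ k‖ := by
  obtain ⟨L, hL, h⟩ := exists_norm_rhoHat_sub_one_le ρ hρ
  refine ⟨(2 * L)⁻¹, by positivity, fun k hk => ?_⟩
  have h1 : L * ‖k‖ ≤ 1 / 2 := by
    calc L * ‖k‖ ≤ L * (2 * L)⁻¹ := by gcongr
      _ = 1 / 2 := by field_simp
  have h2 := norm_sub_norm_le (1 : ℂ) (1 - rhoHat ρ k)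
  rw [norm_one, sub_sub_cancel, norm_sub_rev] at h2
  linarith [h k]

theorem norm_sq_eq_integral_fourier (ψ : L2) : ‖ψ‖ ^ 2 = ∫ k, ‖(𝓕 ψ : L2) k‖ ^ 2 := by
  rw [← Lp.norm_fourier_eq, norm_sq_eq_re_inner (𝕜 := ℂ), L2.inner_def,
    ← integral_re (L2.integrable_inner _ _)]
  congr 1; ext k
  rw [inner_self_eq_norm_sq]

theorem norm_rhoEpsL2_sq (ρ : 𝓢(E3, ℝ)) {ε : ℝ} (hε : 0 < ε) :
    ‖rhoEpsL2 ρ ε‖ ^ 2 = (ε ^ 3)⁻¹ * ∫ k, ‖rhoHat ρ k‖ ^ 2 := by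
  have h1 : ‖rhoEpsL2 ρ ε‖ ^ 2 = ∫ k, ‖rhoHat ρ (ε • k)‖ ^ 2 := by
    rw [norm_sq_eq_integral_fourier]
    refine integral_congr_ae ?_
    filter_upwards [fourier_rhoEpsL2 ρ hε] with k hk
    rw [hk]
  rw [h1, Measure.integral_comp_smul (volume : Measure E3) (fun k => ‖rhoHat ρ k‖ ^ 2) ε,
    finrank_euclideanSpace, Fintype.card_fin, abs_of_pos (by positivity), smul_eq_mul]

theorem integrable_norm_sq_L2 (f : L2) : Integrable fun k => ‖f k‖ ^ 2 :=
  (Lp.memLp f).integrable_norm_pow (by norm_num)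

/-- The charge is controlled by the square root of the kinetic energy of the regular part. -/
theorem exists_charge_bound (ρ : 𝓢(E3, ℝ)) (hρ : ∫ x, ρ x = 1) (M : ℝ) :
    ∃ K : ℝ, 0 < K ∧ ∀ ε : ℝ, 0 < ε → ∀ ψ : L2, ‖ψ‖ ^ 2 ≤ M → ∀ D : ℝ, 0 ≤ D →
      Integrable (fun k => kinetic k *
        ‖(𝓕 ψ : L2) k - charge ρ ε ψ * (rhoHat ρ (ε • k) * (invKinetic k : ℂ))‖ ^ 2) →
      (∫ k, kinetic k *
        ‖(𝓕 ψ : L2) k - charge ρ ε ψ * (rhoHat ρ (ε • k) * (invKinetic k : ℂ))‖ ^ 2) ≤ D ^ 2 →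
      ‖charge ρ ε ψ‖ ^ 2 ≤ K * (1 + D) := by
  obtain ⟨δ, hδ, hδr⟩ := exists_half_le_norm_rhoHat ρ hρ
  have hℓ := ell_pos ρ hρ
  set v := volume.real (Metric.ball (0 : E3) 1) with hv
  have hv0 : 0 < v := by
    rw [hv, Measure.real]
    exact ENNReal.toReal_pos (Metric.measure_ball_pos _ _ one_pos).ne' measure_ball_lt_top.ne
  set A := ∫ k, ‖rhoHat ρ k‖ ^ 2 with hA
  have hA0 : 0 ≤ A := integral_nonneg fun k => by positivity
  set K₁ := (8 * (2 * Real.pi) ^ 4 * |M| + 8 * (2 * Real.pi) ^ 2) / v with hK₁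
  set K₂ := A * |M| / (ell ρ ^ 2 * δ) with hK₂
  have hK₁0 : 0 < K₁ := by positivity
  have hK₂0 : 0 ≤ K₂ := by positivity
  refine ⟨K₁ + K₂, by positivity, fun ε hε ψ hψ D hD hint hle => ?_⟩
  have hψ' : ‖ψ‖ ^ 2 ≤ |M| := hψ.trans (le_abs_self M)
  -- Average over the ball of radius `R = 1 + D`: after division by `R³` the mass term is of order
  -- `R` and the energy term of order `D²/R ≤ R`. This needs `|ρ̂(εk)| ≥ 1/2` on the ball, hence `εR
  -- ≤ δ`. Otherwise `ε⁻¹ < R/δ`, and Cauchy–Schwarz with `‖ρ^ε‖² ~ ε⁻³` already gives `|q|² ≲ ε⁻¹`.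
  rcases le_or_gt (ε * (1 + D)) δ with hsmall | hlarge
  · have hR : 0 < 1 + D := by linarith
    have h := charge_sq_le_of_ball (r := fun k => rhoHat ρ (ε • k)) hR
      (integrable_norm_sq_L2 (𝓕 ψ)) hint (fun k hk => by
        refine hδr _ ?_
        rw [norm_smul, Real.norm_of_nonneg hε.le]
        exact (mul_le_mul_of_nonneg_left hk hε.le).trans hsmall)
    rw [← norm_sq_eq_integral_fourier] at h
    have h1 : (1 + D) ^ 3 * v * ‖charge ρ ε ψ‖ ^ 2 ≤ (1 + D) ^ 3 * v * (K₁ * (1 + D)) := by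
      refine h.trans ?_
      calc _ ≤ 8 * (2 * Real.pi * (1 + D)) ^ 4 * |M| +
            8 * (2 * Real.pi * (1 + D)) ^ 2 * (1 + D) ^ 2 := by
            gcongr
            exact hle.trans (by gcongr; linarith)
        _ = _ := by
            rw [hK₁]
            field_simp
    have h2 := le_of_mul_le_mul_left h1 (by positivity)
    refine h2.trans ?_
    gcongr
    linarith
  · have h1 : ‖charge ρ ε ψ‖ ^ 2 ≤ A * |M| / ell ρ ^ 2 * ε⁻¹ := by
      rw [charge, norm_mul, Complex.norm_real, Real.norm_of_nonneg (by positivity), mul_pow,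
        pairing_eq_inner]
      calc _ ≤ (ε / ell ρ) ^ 2 * (‖rhoEpsL2 ρ ε‖ * ‖ψ‖) ^ 2 := by
            gcongr
            exact norm_inner_le_norm _ _
        _ = (ε / ell ρ) ^ 2 * ((ε ^ 3)⁻¹ * A * ‖ψ‖ ^ 2) := by
            rw [mul_pow, norm_rhoEpsL2_sq ρ hε]
        _ ≤ (ε / ell ρ) ^ 2 * ((ε ^ 3)⁻¹ * A * |M|) := by gcongr
        _ = _ := by field_simp
    have h2 : ε⁻¹ ≤ (1 + D) / δ := by
      rw [inv_eq_one_div, div_le_div_iff₀ hε hδ]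
      linarith
    calc _ ≤ A * |M| / ell ρ ^ 2 * ε⁻¹ := h1
      _ ≤ A * |M| / ell ρ ^ 2 * ((1 + D) / δ) := by gcongr
      _ = K₂ * (1 + D) := by rw [hK₂]; field_simp
      _ ≤ _ := by gcongr; linarith

/-- Subquadratic growth closes an a priori bound. -/
theorem exists_bound_of_sq_le_rpow (A B : ℝ) {p : ℝ} (hp : p < 2) :
    ∃ X : ℝ, 0 ≤ X ∧ ∀ x : ℝ, 0 ≤ x → x ^ 2 ≤ A + B * (1 + x) ^ p → x ≤ X := by
  have h1 : Filter.Tendsto (fun y : ℝ => y ^ (2 - p)) Filter.atTop Filter.atTop :=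
    tendsto_rpow_atTop (by linarith)
  -- Beyond `Y` the term `B (1 + x)^p` is at most `(1 + x)²/4`; the second threshold `2|A| + 4` then
  -- contradicts `x² ≤ A + (1 + x)²/4`.
  obtain ⟨Y, hY⟩ := Filter.eventually_atTop.1
    (h1.eventually_ge_atTop (4 * (|A| + |B| + 1)))
  refine ⟨max Y (2 * |A| + 4), by positivity, fun x hx hle => ?_⟩
  by_contra hcon
  rw [not_le, max_lt_iff] at hcon
  have hxp : 0 < 1 + x := by linarith
  have h2 := hY (1 + x) (by linarith)
  have h3 : (1 + x) ^ (2 - p) * (1 + x) ^ p = (1 + x) ^ 2 := by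
    rw [← Real.rpow_add hxp]; norm_num
  have h4 : 0 < (1 + x) ^ p := Real.rpow_pos_of_pos hxp p
  have h5 : 4 * (|A| + |B| + 1) * (1 + x) ^ p ≤ (1 + x) ^ 2 := by
    rw [← h3]; gcongr
  have h6 : B * (1 + x) ^ p ≤ (1 + x) ^ 2 / 4 := by
    have : B * (1 + x) ^ p ≤ |B| * (1 + x) ^ p := by gcongr; exact le_abs_self B
    nlinarith [abs_nonneg A, mul_nonneg (abs_nonneg A) h4.le]
  nlinarith [le_abs_self A, abs_nonneg A]

/-! ### The initial datum -/

theorem kinetic_mul_invKinetic_sq_le (k : E3) : kinetic k * invKinetic k ^ 2 ≤ invKinetic k := by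
  rcases eq_or_ne k 0 with rfl | hk
  · simp [kinetic, invKinetic]
  · rw [sq, ← mul_assoc, kinetic_mul_invKinetic hk, one_mul]

/-- For `|k| ≥ 1` the `Ḣ²` weight dominates. For `|k| < 1`, `g` is the difference of the square
integrable `b` and a multiple of `|k|⁻²`, and the latter has locally integrable kinetic density.
Thus `φ₀` has finite kinetic energy. -/
theorem kinetic_mul_sq_le {b g : ℂ} {k : E3} {q : ℂ} (hb : b = g + q * (invKinetic k : ℂ)) :
    kinetic k * ‖g‖ ^ 2 ≤ (2 * Real.pi) ^ 2 * (‖k‖ ^ 2 * ‖g‖) ^ 2 +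
      2 * (2 * Real.pi) ^ 2 * ‖b‖ ^ 2 +
      4 * ‖q‖ ^ 2 * ((2 * Real.pi) ^ 2)⁻¹ * (‖k‖ ^ 2 * (1 + ‖k‖ ^ 2))⁻¹ := by
  have hc : 0 < (2 * Real.pi) ^ 2 := by positivity
  rcases le_or_gt 1 ‖k‖ with hk | hk
  · have h1 : kinetic k * ‖g‖ ^ 2 ≤ (2 * Real.pi) ^ 2 * (‖k‖ ^ 2 * ‖g‖) ^ 2 := by
      have h2 : ‖k‖ ^ 2 ≤ (‖k‖ ^ 2) ^ 2 := le_self_pow₀ (one_le_pow₀ hk) (by norm_num)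
      calc kinetic k * ‖g‖ ^ 2 = (2 * Real.pi) ^ 2 * (‖k‖ ^ 2 * ‖g‖ ^ 2) := by rw [kinetic]; ring
        _ ≤ (2 * Real.pi) ^ 2 * ((‖k‖ ^ 2) ^ 2 * ‖g‖ ^ 2) := by gcongr
        _ = _ := by ring
    have h3 : 0 ≤ 2 * (2 * Real.pi) ^ 2 * ‖b‖ ^ 2 := by positivity
    have h4 : 0 ≤ 4 * ‖q‖ ^ 2 * ((2 * Real.pi) ^ 2)⁻¹ * (‖k‖ ^ 2 * (1 + ‖k‖ ^ 2))⁻¹ := by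
      positivity
    linarith
  · have h0 : 0 ≤ (2 * Real.pi) ^ 2 * (‖k‖ ^ 2 * ‖g‖) ^ 2 := by positivity
    have hg : ‖g‖ ≤ ‖b‖ + ‖q‖ * invKinetic k := by
      have : g = b - q * (invKinetic k : ℂ) := by rw [hb]; ring
      rw [this]
      refine (norm_sub_le _ _).trans (le_of_eq ?_)
      rw [norm_mul, Complex.norm_real, Real.norm_of_nonneg (invKinetic_nonneg k)]
    have hg2 : ‖g‖ ^ 2 ≤ 2 * ‖b‖ ^ 2 + 2 * (‖q‖ ^ 2 * invKinetic k ^ 2) := by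
      refine (pow_le_pow_left₀ (norm_nonneg _) hg 2).trans ?_
      nlinarith [sq_nonneg (‖b‖ - ‖q‖ * invKinetic k)]
    have hk2 : kinetic k ≤ (2 * Real.pi) ^ 2 := by
      rw [kinetic, mul_pow]
      exact mul_le_of_le_one_right hc.le (pow_le_one₀ (norm_nonneg _) hk.le)
    have hinv : invKinetic k ≤
        2 * ((2 * Real.pi) ^ 2)⁻¹ * (‖k‖ ^ 2 * (1 + ‖k‖ ^ 2))⁻¹ := by
      rcases eq_or_ne k 0 with rfl | hk0
      · simp [invKinetic]
      have := norm_pos_iff.2 hk0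
      have e1 : invKinetic k = 1 / ((2 * Real.pi) ^ 2 * ‖k‖ ^ 2) := by
        rw [invKinetic, mul_pow, one_div]
      have e2 : 2 * ((2 * Real.pi) ^ 2)⁻¹ * (‖k‖ ^ 2 * (1 + ‖k‖ ^ 2))⁻¹ =
          2 / ((2 * Real.pi) ^ 2 * (‖k‖ ^ 2 * (1 + ‖k‖ ^ 2))) := by
        rw [div_eq_mul_inv, mul_inv ((2 * Real.pi) ^ 2)]; ring
      rw [e1, e2, div_le_div_iff₀ (by positivity) (by positivity)]
      have h1 : ‖k‖ ^ 2 ≤ 1 := pow_le_one₀ (norm_nonneg _) hk.le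
      have h2 : 0 ≤ (2 * Real.pi) ^ 2 * ‖k‖ ^ 2 := by positivity
      nlinarith
    calc kinetic k * ‖g‖ ^ 2
        ≤ kinetic k * (2 * ‖b‖ ^ 2 + 2 * (‖q‖ ^ 2 * invKinetic k ^ 2)) := by
          have := kinetic_nonneg k
          gcongr
      _ = 2 * kinetic k * ‖b‖ ^ 2 + 2 * ‖q‖ ^ 2 * (kinetic k * invKinetic k ^ 2) := by ring
      _ ≤ 2 * (2 * Real.pi) ^ 2 * ‖b‖ ^ 2 + 2 * ‖q‖ ^ 2 *
          (2 * ((2 * Real.pi) ^ 2)⁻¹ * (‖k‖ ^ 2 * (1 + ‖k‖ ^ 2))⁻¹) := by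
          have := (kinetic_mul_invKinetic_sq_le k).trans hinv
          gcongr
      _ ≤ _ := by nlinarith

/-- The Fourier transform of the regular part of an element of the domain of the limit operator. -/
theorem IsInDomain.exists_fourier {γ μ : ℝ} {ψ₀ φ₀ : E3 → ℂ} {q₀ : ℂ}
    (h : IsInDomain γ μ ψ₀ φ₀ q₀) :
    ∃ g b : E3 → ℂ, HasFourier φ₀ g ∧ AEStronglyMeasurable g ∧
      Integrable (fun k => kinetic k * ‖g k‖ ^ 2) ∧ Integrable (fun k => ‖b k‖ ^ 2) ∧
      b =ᵐ[volume] fun k => g k + q₀ * (invKinetic k : ℂ) := by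
  obtain ⟨u, hu, g, _, hg, hg2⟩ := h.regular_mem
  have H := hu.hasFourier hg
  have H0 : HasFourier ψ₀ (𝓕 h.memLp.toLp : L2) :=
    (hasFourier_L2 h.memLp.toLp).congr h.memLp.coeFn_toLp Filter.EventuallyEq.rfl
  -- The sum is square integrable because `ψ₀` is, although `q₀ / (2π|k|)²` is not when `q₀ ≠ 0`.
  have hb := H0.unique ((H.add (hasFourier_G.const_mul q₀)).congr h.decomposition.symm
    Filter.EventuallyEq.rfl)
  have hgm := H.locallyIntegrable.2.aestronglyMeasurable
  have hb2 := integrable_norm_sq_L2 (𝓕 h.memLp.toLp)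
  refine ⟨g, (𝓕 h.memLp.toLp : L2), H, hgm, ?_, hb2, hb⟩
  have hg4 : Integrable fun k => (‖k‖ ^ 2 * ‖g k‖) ^ 2 := by
    refine (hg2.integrable_norm_pow (by norm_num)).congr (Filter.Eventually.of_forall fun k => ?_)
    simp
  refine (((hg4.const_mul ((2 * Real.pi) ^ 2)).add
    (hb2.const_mul (2 * (2 * Real.pi) ^ 2))).add
    (integrable_inv_sq_mul_one_add_sq.const_mul (4 * ‖q₀‖ ^ 2 * ((2 * Real.pi) ^ 2)⁻¹))).mono'
    (continuous_kinetic.aestronglyMeasurable.mul (hgm.norm.pow 2)) ?_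
  filter_upwards [hb] with k hk
  rw [Real.norm_of_nonneg (mul_nonneg (kinetic_nonneg k) (by positivity))]
  exact kinetic_mul_sq_le hk

/-- The Lipschitz bound tames `|k|⁻⁴` at the origin and boundedness of `r` suffices at infinity: the
difference between `ρ^ε * G` and `G` lies in `L²` even though neither transform need. -/
theorem norm_sub_one_sq_mul_invKinetic_sq_le {L : ℝ} {k : E3} {r : ℂ}
    (h1 : ‖r‖ ≤ 1) (h2 : ‖r - 1‖ ≤ L * ‖k‖) :
    ‖r - 1‖ ^ 2 * invKinetic k ^ 2 ≤
      (L ^ 2 + 4) * ((2 * Real.pi) ^ 4)⁻¹ * (‖k‖ ^ 2 * (1 + ‖k‖ ^ 2))⁻¹ := by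
  rcases eq_or_ne k 0 with rfl | hk0
  · simp [invKinetic]
  have hk := norm_pos_iff.2 hk0
  have h3 : ‖r - 1‖ ≤ 2 := (norm_sub_le _ _).trans (by rw [norm_one]; linarith)
  have h4 : ‖r - 1‖ ^ 2 ≤ 4 := by nlinarith [norm_nonneg (r - 1)]
  have h5 : ‖r - 1‖ ^ 2 ≤ L ^ 2 * ‖k‖ ^ 2 := by
    rw [← mul_pow]; exact pow_le_pow_left₀ (norm_nonneg _) h2 2
  have h6 : ‖r - 1‖ ^ 2 * (1 + ‖k‖ ^ 2) ≤ (L ^ 2 + 4) * ‖k‖ ^ 2 := by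
    nlinarith [mul_le_mul_of_nonneg_right h4 (sq_nonneg (‖k‖))]
  rw [invKinetic]
  have e1 : ‖r - 1‖ ^ 2 * ((2 * Real.pi * ‖k‖) ^ 2)⁻¹ ^ 2 =
      ‖r - 1‖ ^ 2 / ((2 * Real.pi) ^ 4 * ‖k‖ ^ 4) := by
    rw [div_eq_mul_inv, ← inv_pow]; ring
  have e2 : (L ^ 2 + 4) * ((2 * Real.pi) ^ 4)⁻¹ * (‖k‖ ^ 2 * (1 + ‖k‖ ^ 2))⁻¹ =
      (L ^ 2 + 4) / ((2 * Real.pi) ^ 4 * (‖k‖ ^ 2 * (1 + ‖k‖ ^ 2))) := by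
    rw [div_eq_mul_inv, mul_inv ((2 * Real.pi) ^ 4)]; ring
  rw [e1, e2, div_le_div_iff₀ (by positivity) (by positivity)]
  have h7 := mul_le_mul_of_nonneg_left h6
    (by positivity : (0 : ℝ) ≤ (2 * Real.pi) ^ 4 * ‖k‖ ^ 2)
  linarith

/-- The regularised initial data have uniformly bounded mass. -/
theorem exists_initial_mass_bound (ρ : 𝓢(E3, ℝ)) (hρ0 : ∀ x, 0 ≤ ρ x) (hρ : ∫ x, ρ x = 1)
    {g b : E3 → ℂ} {q₀ : ℂ} (hb2 : Integrable fun k => ‖b k‖ ^ 2)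
    (hb : b =ᵐ[volume] fun k => g k + q₀ * (invKinetic k : ℂ)) :
    ∃ M : ℝ, ∀ ε : ℝ, 0 < ε → ε < 1 →
      ∫ k, ‖g k + q₀ * (rhoHat ρ (ε • k) * (invKinetic k : ℂ))‖ ^ 2 ≤ M := by
  obtain ⟨L, hL, hLk⟩ := exists_norm_rhoHat_sub_one_le ρ hρ
  refine ⟨∫ k : E3, (2 * ‖b k‖ ^ 2 + 2 * ‖q₀‖ ^ 2 * ((L ^ 2 + 4) * ((2 * Real.pi) ^ 4)⁻¹) *
    (‖k‖ ^ 2 * (1 + ‖k‖ ^ 2))⁻¹), fun ε hε hε1 => ?_⟩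
  refine integral_mono_of_nonneg (Filter.Eventually.of_forall fun k => by positivity)
    ((hb2.const_mul 2).add (integrable_inv_sq_mul_one_add_sq.const_mul _)) ?_
  filter_upwards [hb] with k hk
  -- Compare with the fixed `L²` datum `ψ₀`; the error is a multiple of `ρ^ε * G - G`, bounded
  -- uniformly for `ε < 1`.
  have h1 : g k + q₀ * (rhoHat ρ (ε • k) * (invKinetic k : ℂ)) =
      b k + q₀ * ((rhoHat ρ (ε • k) - 1) * (invKinetic k : ℂ)) := by
    rw [hk]; ring
  have h2 : ‖rhoHat ρ (ε • k) - 1‖ ≤ L * ‖k‖ := by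
    refine (hLk _).trans ?_
    rw [norm_smul, Real.norm_of_nonneg hε.le]
    gcongr
    exact mul_le_of_le_one_left (norm_nonneg _) hε1.le
  have h3 := norm_sub_one_sq_mul_invKinetic_sq_le (norm_rhoHat_le ρ hρ0 hρ _) h2
  simp only [h1]
  have h4 : ‖b k + q₀ * ((rhoHat ρ (ε • k) - 1) * (invKinetic k : ℂ))‖ ^ 2 ≤
      2 * ‖b k‖ ^ 2 + 2 * ‖q₀‖ ^ 2 * (‖rhoHat ρ (ε • k) - 1‖ ^ 2 * invKinetic k ^ 2) := by
    refine (pow_le_pow_left₀ (norm_nonneg _) (norm_add_le _ _) 2).trans ?_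
    rw [norm_mul, norm_mul, Complex.norm_real, Real.norm_of_nonneg (invKinetic_nonneg k)]
    nlinarith [sq_nonneg (‖b k‖ - ‖q₀‖ * (‖rhoHat ρ (ε • k) - 1‖ * invKinetic k))]
  refine h4.trans ?_
  rw [mul_assoc (2 * ‖q₀‖ ^ 2)]
  gcongr

theorem finiteEnergy_rhoHat_smul (ρ : 𝓢(E3, ℝ)) {ε : ℝ} (hε : 0 < ε) :
    FiniteEnergy fun k => rhoHat ρ (ε • k) := by
  have h1 : Integrable fun k => ‖rhoHat ρ (ε • k)‖ ^ 2 := by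
    have := ((𝓕 (rhoS ρ hε) : 𝓢(E3, ℂ)).memLp 2).integrable_norm_pow (by norm_num)
    simpa only [fourier_rhoS] using this
  have h2 : Integrable fun k => (kinetic k * ‖rhoHat ρ (ε • k)‖) ^ 2 := by
    have := (memLp_kinetic_mul_schwartz (𝓕 (rhoS ρ hε))).integrable_norm_pow (by norm_num)
    simp only [fourier_rhoS] at this
    refine this.congr (Filter.Eventually.of_forall fun k => ?_)
    have hk : ‖(2 * Real.pi * ‖k‖) ^ 2‖ = kinetic k := Real.norm_of_nonneg (kinetic_nonneg k)
    simp only [norm_mul, Complex.norm_real, hk]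
  have hc : Continuous fun k : E3 => rhoHat ρ (ε • k) :=
    (rhoHat ρ).continuous.comp (continuous_const_smul ε)
  refine ⟨h1, (h1.add h2).mono' (continuous_kinetic.mul (hc.norm.pow 2)).aestronglyMeasurable
    (Filter.Eventually.of_forall fun k => ?_)⟩
  rw [Real.norm_of_nonneg (mul_nonneg (kinetic_nonneg k) (by positivity)), Pi.add_apply]
  have := sq_nonneg (‖rhoHat ρ (ε • k)‖)
  nlinarith [mul_nonneg this (sq_nonneg (kinetic k - 1)), mul_nonneg this (kinetic_nonneg k)]

theorem integrable_kinetic_initial {ρ : 𝓢(E3, ℝ)} {ε : ℝ} (hε : 0 < ε) {g : E3 → ℂ} (q₀ : ℂ)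
    (hgm : AEStronglyMeasurable g) (hg : Integrable fun k => kinetic k * ‖g k‖ ^ 2) :
    Integrable fun k =>
      kinetic k * ‖g k + q₀ * (rhoHat ρ (ε • k) * (invKinetic k : ℂ))‖ ^ 2 := by
  have hc : Continuous fun k : E3 => rhoHat ρ (ε • k) :=
    (rhoHat ρ).continuous.comp (continuous_const_smul ε)
  have hm : AEStronglyMeasurable fun k =>
      g k + q₀ * (rhoHat ρ (ε • k) * (invKinetic k : ℂ)) :=
    hgm.add (aestronglyMeasurable_const.mul (hc.aestronglyMeasurable.mul
      (Complex.measurable_ofReal.comp measurable_invKinetic).aestronglyMeasurable))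
  refine ((hg.const_mul 2).add
    ((integrable_rhoHat_sq_mul_invKinetic ρ hε).const_mul (2 * ‖q₀‖ ^ 2))).mono'
    (continuous_kinetic.aestronglyMeasurable.mul (hm.norm.pow 2))
    (Filter.Eventually.of_forall fun k => ?_)
  have hK := kinetic_nonneg k
  have hJ := invKinetic_nonneg k
  rw [Real.norm_of_nonneg (mul_nonneg hK (by positivity)), Pi.add_apply]
  have h4 : ‖g k + q₀ * (rhoHat ρ (ε • k) * (invKinetic k : ℂ))‖ ^ 2 ≤
      2 * ‖g k‖ ^ 2 + 2 * ‖q₀‖ ^ 2 * (‖rhoHat ρ (ε • k)‖ ^ 2 * invKinetic k ^ 2) := by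
    refine (pow_le_pow_left₀ (norm_nonneg _) (norm_add_le _ _) 2).trans ?_
    rw [norm_mul, norm_mul, Complex.norm_real, Real.norm_of_nonneg hJ]
    nlinarith [sq_nonneg (‖g k‖ - ‖q₀‖ * (‖rhoHat ρ (ε • k)‖ * invKinetic k))]
  calc _ ≤ kinetic k * (2 * ‖g k‖ ^ 2 +
        2 * ‖q₀‖ ^ 2 * (‖rhoHat ρ (ε • k)‖ ^ 2 * invKinetic k ^ 2)) := by gcongr
    _ = 2 * (kinetic k * ‖g k‖ ^ 2) + 2 * ‖q₀‖ ^ 2 *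
        (‖rhoHat ρ (ε • k)‖ ^ 2 * (kinetic k * invKinetic k ^ 2)) := by ring
    _ ≤ _ := by
      have := kinetic_mul_invKinetic_sq_le k
      gcongr

/-! ### Conservation laws in terms of the charge and the regular part -/

/-- The kinetic energy `‖∇φ^ε‖²` of the regular part `φ^ε` of `ψ`. -/
noncomputable def regularEnergy (ρ : 𝓢(E3, ℝ)) (ε : ℝ) (ψ : L2) : ℝ :=
  ∫ k, kinetic k *
    ‖(𝓕 ψ : L2) k - charge ρ ε ψ * (rhoHat ρ (ε • k) * (invKinetic k : ℂ))‖ ^ 2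

theorem charge_mul_eq (ρ : 𝓢(E3, ℝ)) (hρ : ∫ x, ρ x = 1) {ε : ℝ} (hε : 0 < ε) (ψ : E3 → ℂ) :
    charge ρ ε ψ * ((ell ρ / ε : ℝ) : ℂ) = pairing ρ ε ψ := by
  have h := ell_pos ρ hρ
  have : ((ε / ell ρ : ℝ) : ℂ) * ((ell ρ / ε : ℝ) : ℂ) = 1 := by
    rw [← Complex.ofReal_mul, ← Complex.ofReal_one]
    congr 1; field_simp
  rw [charge]
  linear_combination pairing ρ ε ψ * this

/-- The orthogonal splitting with `Λ = ℓ/ε`, whose projection coefficient is exactly `charge`. -/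
theorem regularEnergy_eq (ρ : 𝓢(E3, ℝ)) (hρ : ∫ x, ρ x = 1) {ε : ℝ} (hε : 0 < ε) (ψ : L2)
    (hψ : Integrable fun k => kinetic k * ‖(𝓕 ψ : L2) k‖ ^ 2) :
    Integrable (fun k => kinetic k *
      ‖(𝓕 ψ : L2) k - charge ρ ε ψ * (rhoHat ρ (ε • k) * (invKinetic k : ℂ))‖ ^ 2) ∧
    regularEnergy ρ ε ψ = (∫ k, kinetic k * ‖(𝓕 ψ : L2) k‖ ^ 2) -
      ell ρ / ε * ‖charge ρ ε ψ‖ ^ 2 :=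
  integral_kinetic_sub (Lp.aestronglyMeasurable _)
    ((rhoHat ρ).continuous.comp (continuous_const_smul ε)) hψ
    (integrable_rhoHat_sq_mul_invKinetic ρ hε) (integral_rhoHat_sq_mul_invKinetic ρ hε)
    (pairing_eq ρ hε ψ).symm (charge_mul_eq ρ hρ hε ψ)

theorem gradNorm_regularPart_le (ρ : 𝓢(E3, ℝ)) (hρ : ∫ x, ρ x = 1) {ε : ℝ} (hε : 0 < ε) (ψ : L2)
    (hψ : Integrable fun k => kinetic k * ‖(𝓕 ψ : L2) k‖ ^ 2) :
    gradNorm (regularPart ρ ε ψ) ≤ ENNReal.ofReal (Real.sqrt (regularEnergy ρ ε ψ)) := by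
  have H := (hasFourier_L2 ψ).add ((hasFourier_rhoConvG ρ hε).const_mul (-charge ρ ε ψ))
  have hint := (regularEnergy_eq ρ hρ hε ψ hψ).1
  set h : E3 → ℂ := fun k =>
    (𝓕 ψ : L2) k + -charge ρ ε ψ * (rhoHat ρ (ε • k) * (invKinetic k : ℂ)) with hh
  have he : ∀ k, ‖((2 * Real.pi * ‖k‖ : ℝ) : ℂ) * h k‖ ^ 2 = kinetic k *
      ‖(𝓕 ψ : L2) k - charge ρ ε ψ * (rhoHat ρ (ε • k) * (invKinetic k : ℂ))‖ ^ 2 := by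
    intro k
    rw [norm_mul, mul_pow, Complex.norm_real, Real.norm_eq_abs, sq_abs, kinetic]
    simp only [hh, neg_mul, ← sub_eq_add_neg]
  have hm : AEStronglyMeasurable fun k : E3 => ((2 * Real.pi * ‖k‖ : ℝ) : ℂ) * h k := by
    refine AEStronglyMeasurable.mul ?_ H.locallyIntegrable.2.aestronglyMeasurable
    exact (by fun_prop : Continuous fun k : E3 =>
      ((2 * Real.pi * ‖k‖ : ℝ) : ℂ)).aestronglyMeasurable
  have hmem : MemLp (fun k : E3 => ((2 * Real.pi * ‖k‖ : ℝ) : ℂ) * h k) 2 := by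
    rw [memLp_two_iff_integrable_sq_norm hm]
    simpa only [he] using hint
  have hu : (fun x => ψ x + -charge ρ ε ψ * (rhoConvG ρ ε x : ℂ)) = regularPart ρ ε ψ := by
    ext x; rw [regularPart]; ring
  rw [hu] at H
  refine (gradNorm_le_of_hasFourier H hmem).trans (le_of_eq ?_)
  rw [hmem.eLpNorm_eq_integral_rpow_norm (by norm_num) (by norm_num)]
  rw [regularEnergy, Real.sqrt_eq_rpow, ENNReal.toReal_ofNat, one_div]
  simp only [← he, Real.rpow_two]

theorem norm_charge (ρ : 𝓢(E3, ℝ)) (hρ : ∫ x, ρ x = 1) {ε : ℝ} (hε : 0 < ε) (ψ : E3 → ℂ) :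
    ‖charge ρ ε ψ‖ = ε / ell ρ * ‖pairing ρ ε ψ‖ := by
  have := ell_pos ρ hρ
  rw [charge, norm_mul, Complex.norm_real, Real.norm_of_nonneg (by positivity)]

theorem norm_charge_sq_rpow (ρ : 𝓢(E3, ℝ)) (hρ : ∫ x, ρ x = 1) {ε : ℝ} (hε : 0 < ε) (μ : ℝ)
    (ψ : E3 → ℂ) :
    (‖charge ρ ε ψ‖ ^ 2) ^ (μ + 1) = ε ^ (2 + 2 * μ) / ell ρ ^ (2 + 2 * μ) *
      (‖pairing ρ ε ψ‖ ^ 2) ^ (μ + 1) := by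
  have hℓ := ell_pos ρ hρ
  have h0 : 0 ≤ ε / ell ρ := by positivity
  rw [norm_charge ρ hρ hε, mul_pow, Real.mul_rpow (by positivity) (by positivity),
    ← Real.div_rpow hε.le hℓ.le, ← Real.rpow_two (ε / ell ρ), ← Real.rpow_mul h0]
  congr 2
  ring

/-- Mass and energy of a solution of the scaled problem are conserved; the energy is expressed in
terms of the regular part and the charge. -/
theorem IsScaledSolution.conservation {ρ : 𝓢(E3, ℝ)} (hρ : ∫ x, ρ x = 1) {γ μ ε T : ℝ}
    {ψ₀ : E3 → ℂ} {ψ : ℝ → L2} (hψ : IsScaledSolution ρ γ μ ε T ψ₀ ψ) (hε : 0 < ε) (hμ : 0 ≤ μ)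
    (hfin : FiniteEnergy (𝓕 (ψ 0) : L2)) {t : ℝ} (ht : t ∈ Icc 0 T) :
    (Integrable fun k => kinetic k * ‖(𝓕 (ψ t) : L2) k‖ ^ 2) ∧ ‖ψ t‖ ^ 2 = ‖ψ 0‖ ^ 2 ∧
      regularEnergy ρ ε (ψ t) + γ / (μ + 1) * (‖charge ρ ε (ψ t)‖ ^ 2) ^ (μ + 1) =
        regularEnergy ρ ε (ψ 0) + γ / (μ + 1) * (‖charge ρ ε (ψ 0)‖ ^ 2) ^ (μ + 1) := by
  have hT : 0 ≤ T := ht.1.trans ht.2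
  have hℓ := ell_pos ρ hρ
  set a₀ : E3 → ℂ := ((𝓕 (ψ 0) : L2) : E3 → ℂ) with ha₀
  set r : E3 → ℂ := fun k => rhoHat ρ (ε • k) with hr
  set f := source ρ γ μ ε hT ψ with hf
  have ha : AEStronglyMeasurable a₀ := Lp.aestronglyMeasurable _
  have hrc : Continuous r := (rhoHat ρ).continuous.comp (continuous_const_smul ε)
  have hfc : Continuous f := continuous_source ρ γ hμ ε hT hψ.continuousOn
  have hrfin : FiniteEnergy r := finiteEnergy_rhoHat_smul ρ hε
  have hamp : ∀ s ∈ Icc 0 T, (𝓕 (ψ s) : L2) =ᵐ[volume] amp a₀ r f s := fun s hs =>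
    hψ.fourier_ae hε hμ hT hs
  set z : ℝ → ℂ := fun s => ∫ k, starRingEnd ℂ (r k) * amp a₀ r f s k with hz
  have hzp : ∀ s ∈ Icc 0 T, z s = pairing ρ ε (ψ s) := by
    intro s hs
    rw [pairing_eq ρ hε, hz]
    refine integral_congr_ae ?_
    filter_upwards [hamp s hs] with k hk
    rw [hk]
  have h0 : (0 : ℝ) ∈ Icc 0 T := ⟨le_rfl, hT⟩
  have hcons := mass_energy_conservation (T := T) (c := ε / ell ρ)
    (b := γ * (ε ^ (2 + 2 * μ) / ell ρ ^ (2 + 2 * μ))) hμ ha hrc hfc hfin hrfin hz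
    (fun s hs => by rw [hzp s hs, hf, source_of_mem ρ γ μ ε hT ψ hs, coupling]) t ht
  have hkin := integrable_weight_mul_norm_amp_sq continuous_kinetic.measurable kinetic_nonneg
    ha hrc hfc hfin.kinetic hrfin.kinetic t
  have hsq : (fun k => ‖(𝓕 (ψ t) : L2) k‖ ^ 2) =ᵐ[volume] fun k => ‖amp a₀ r f t k‖ ^ 2 := by
    filter_upwards [hamp t ht] with k hk
    rw [hk]
  have hksq : (fun k => kinetic k * ‖(𝓕 (ψ t) : L2) k‖ ^ 2) =ᵐ[volume]
      fun k => kinetic k * ‖amp a₀ r f t k‖ ^ 2 := by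
    filter_upwards [hamp t ht] with k hk
    rw [hk]
  have hkint := hkin.congr hksq.symm
  refine ⟨hkint, ?_, ?_⟩
  · rw [norm_sq_eq_integral_fourier, norm_sq_eq_integral_fourier, integral_congr_ae hsq, hcons.1]
  · have hE := hcons.2
    rw [hzp t ht, hzp 0 h0, ← integral_congr_ae hksq] at hE
    rw [(regularEnergy_eq ρ hρ hε _ hkint).2, (regularEnergy_eq ρ hρ hε _ hfin.kinetic).2,
      norm_charge_sq_rpow ρ hρ hε, norm_charge_sq_rpow ρ hρ hε, norm_charge ρ hρ hε,
      norm_charge ρ hρ hε]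
    -- The key cancellation: the part split off from the kinetic energy equals the linear
    -- interaction energy.
    have e : ∀ x : ℝ, ell ρ / ε * (ε / ell ρ * x) ^ 2 = ε / ell ρ * x ^ 2 := by
      intro x; field_simp
    rw [e, e]
    linear_combination hE

/-- The regular part and the charge of the regularised initial datum are bounded by those of the
limit datum. -/
theorem initial_bounds {ρ : 𝓢(E3, ℝ)} (hρ : ∫ x, ρ x = 1) {ε : ℝ} (hε : 0 < ε) (hε1 : ε < 1)
    {g : E3 → ℂ} {q₀ : ℂ} (hgm : AEStronglyMeasurable g)
    (hg : Integrable fun k => kinetic k * ‖g k‖ ^ 2) {ψ : L2}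
    (hψ : (𝓕 ψ : L2) =ᵐ[volume]
      fun k => g k + q₀ * (rhoHat ρ (ε • k) * (invKinetic k : ℂ))) :
    regularEnergy ρ ε ψ ≤ ∫ k, kinetic k * ‖g k‖ ^ 2 ∧
      ‖charge ρ ε ψ‖ ^ 2 ≤ 2 * ‖q₀‖ ^ 2 + 2 * (∫ k, kinetic k * ‖g k‖ ^ 2) / ell ρ := by
  have hℓ := ell_pos ρ hρ
  have hΛ : 0 < ell ρ / ε := by positivity
  have hrc : Continuous fun k : E3 => rhoHat ρ (ε • k) :=
    (rhoHat ρ).continuous.comp (continuous_const_smul ε)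
  have hir := integrable_rhoHat_sq_mul_invKinetic ρ hε
  have hrΛ := integral_rhoHat_sq_mul_invKinetic ρ hε
  have hi := integrable_conj_mul_of_kinetic hgm hrc hg hir
  have hzg : ∫ k, starRingEnd ℂ (rhoHat ρ (ε • k)) * g k =
      (charge ρ ε ψ - q₀) * ((ell ρ / ε : ℝ) : ℂ) := by
    rw [sub_mul, charge_mul_eq ρ hρ hε, pairing_eq ρ hε, ← hrΛ, ← integral_complex_ofReal,
      ← integral_const_mul, eq_sub_iff_add_eq]
    refine (integral_add hi (hir.ofReal.const_mul q₀)).symm.trans (integral_congr_ae ?_)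
    filter_upwards [hψ] with k hk
    rw [hk, mul_add]
    congr 1
    rw [mul_left_comm, ← mul_assoc (starRingEnd ℂ _), Complex.conj_mul']
    push_cast; rfl
  -- The regular part of the datum is `φ₀ - (q^ε - q₀) ρ^ε * G`, which is the kinetic projection of
  -- `φ₀`. Its energy is therefore that of `φ₀` minus `(ℓ/ε)|q^ε - q₀|²`, and nonnegativity bounds
  -- the charge too.
  have hproj := integral_kinetic_sub hgm hrc hg hir hrΛ hzg (q := charge ρ ε ψ - q₀) rfl
  have hE : regularEnergy ρ ε ψ =
      (∫ k, kinetic k * ‖g k‖ ^ 2) - ell ρ / ε * ‖charge ρ ε ψ - q₀‖ ^ 2 := by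
    rw [← hproj.2, regularEnergy]
    refine integral_congr_ae ?_
    filter_upwards [hψ] with k hk
    rw [hk]
    congr 3
    ring
  have hE0 : 0 ≤ regularEnergy ρ ε ψ :=
    integral_nonneg fun k => mul_nonneg (kinetic_nonneg k) (by positivity)
  have hsq := sq_nonneg (‖charge ρ ε ψ - q₀‖)
  refine ⟨?_, ?_⟩
  · rw [hE]
    nlinarith
  · have h1 : ell ρ * ‖charge ρ ε ψ - q₀‖ ^ 2 ≤ ∫ k, kinetic k * ‖g k‖ ^ 2 := by
      have h2 : ell ρ ≤ ell ρ / ε := by rw [le_div_iff₀ hε]; nlinarith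
      nlinarith
    have h3 : ‖charge ρ ε ψ - q₀‖ ^ 2 ≤ (∫ k, kinetic k * ‖g k‖ ^ 2) / ell ρ := by
      rw [le_div_iff₀ hℓ]; linarith
    have h4 : ‖charge ρ ε ψ‖ ≤ ‖q₀‖ + ‖charge ρ ε ψ - q₀‖ := by
      simpa using norm_add_le q₀ (charge ρ ε ψ - q₀)
    rw [mul_div_assoc]
    nlinarith [norm_nonneg (charge ρ ε ψ), sq_nonneg (‖q₀‖ - ‖charge ρ ε ψ - q₀‖),
      norm_nonneg q₀, norm_nonneg (charge ρ ε ψ - q₀)]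

/-- The conserved energy together with the charge estimate bounds the kinetic energy of the regular
part, in the defocusing case and in the focusing subcritical case. -/
theorem exists_bound_of_energy {γ μ : ℝ} (hγμ : (0 ≤ γ ∧ 0 ≤ μ) ∨ (γ < 0 ∧ 0 ≤ μ ∧ μ < 1))
    (E K : ℝ) (hK : 0 < K) :
    ∃ X : ℝ, 0 ≤ X ∧ ∀ D Q : ℝ, 0 ≤ D → 0 ≤ Q → Q ≤ K * (1 + D) →
      D ^ 2 + γ / (μ + 1) * Q ^ (μ + 1) ≤ E → D ≤ X := by
  rcases hγμ with ⟨hγ, hμ⟩ | ⟨hγ, hμ, hμ1⟩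
  · refine ⟨Real.sqrt E, Real.sqrt_nonneg _, fun D Q hD hQ _ hle => Real.le_sqrt_of_sq_le ?_⟩
    have : 0 ≤ γ / (μ + 1) * Q ^ (μ + 1) := by positivity
    linarith
  -- Inserting `Q ≤ K(1 + D)` in the negative term produces the power `(1 + D)^(μ+1)`;
  -- subcriticality `μ < 1` is precisely `p < 2`.
  · obtain ⟨X, hX, h⟩ := exists_bound_of_sq_le_rpow E (-γ / (μ + 1) * K ^ (μ + 1))
      (p := μ + 1) (by linarith)
    refine ⟨X, hX, fun D Q hD hQ hQK hle => h D hD ?_⟩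
    have h1 : Q ^ (μ + 1) ≤ K ^ (μ + 1) * (1 + D) ^ (μ + 1) := by
      rw [← Real.mul_rpow hK.le (by linarith)]
      exact Real.rpow_le_rpow hQ hQK (by linarith)
    have h2 : 0 ≤ -γ / (μ + 1) := div_nonneg (by linarith) (by linarith)
    have h3 := mul_le_mul_of_nonneg_left h1 h2
    have h4 : γ / (μ + 1) * Q ^ (μ + 1) = -(-γ / (μ + 1) * Q ^ (μ + 1)) := by ring
    rw [mul_assoc]
    linarith

end PointNLS

/-! ### The uniform bounds. -/

theorem proposition4p4
    (ρ : 𝓢(PointNLS.E3, ℝ)) (hρ_nonneg : ∀ x, 0 ≤ ρ x)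
    (hρ_radial : ∀ x y : PointNLS.E3, ‖x‖ = ‖y‖ → ρ x = ρ y)
    (hρ_int : ∫ x, ρ x = 1)
    (γ μ : ℝ) (hγμ : (0 ≤ γ ∧ 0 ≤ μ) ∨ (γ < 0 ∧ 0 ≤ μ ∧ μ < 1))
    (ψ₀ φ₀ : PointNLS.E3 → ℂ) (q₀ : ℂ) (hψ₀ : PointNLS.IsInDomain γ μ ψ₀ φ₀ q₀)
    (T : ℝ) (hT : 0 < T) :
    ∃ ε₀ : ℝ, 0 < ε₀ ∧ ∃ C : ℝ, 0 < C ∧ ∀ ε : ℝ, 0 < ε → ε < ε₀ →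
      ∀ ψ : ℝ → PointNLS.L2,
        PointNLS.IsScaledSolution ρ γ μ ε T
          (fun x => φ₀ x + q₀ * (PointNLS.rhoConvG ρ ε x : ℂ)) ψ →
        (∀ t ∈ Icc (0 : ℝ) T,
          PointNLS.gradNorm (PointNLS.regularPart ρ ε (ψ t)) ≤ ENNReal.ofReal C) ∧
        (∀ t ∈ Icc (0 : ℝ) T, ‖PointNLS.charge ρ ε (ψ t)‖ ≤ C) := by
  open PointNLS in
  have hμ : 0 ≤ μ := hγμ.elim (fun h => h.2) fun h => h.2.1
  obtain ⟨g, b, hφg, hgm, hg, hb2, hb⟩ := hψ₀.exists_fourier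
  obtain ⟨M, hM⟩ := exists_initial_mass_bound ρ hρ_nonneg hρ_int hb2 hb
  obtain ⟨K, hK, hcharge⟩ := exists_charge_bound ρ hρ_int M
  set E₀ := ∫ k, kinetic k * ‖g k‖ ^ 2 with hE₀
  set Q₀ := 2 * ‖q₀‖ ^ 2 + 2 * E₀ / ell ρ with hQ₀
  -- A bound on the initial energy that does not involve `ε`; `|γ|` covers both signs.
  obtain ⟨X, hX, hbound⟩ := exists_bound_of_energy hγμ (E₀ + |γ| / (μ + 1) * Q₀ ^ (μ + 1)) K hK
  -- `X` bounds the gradient, and `K * (1 + X) + 1` bounds the charge through `2|q| ≤ |q|² + 1`.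
  refine ⟨1, one_pos, X + K * (1 + X) + 1, by positivity, fun ε hε hε1 ψ hψ => ?_⟩
  have hψF : (𝓕 (ψ 0) : L2) =ᵐ[volume]
      fun k => g k + q₀ * (rhoHat ρ (ε • k) * (invKinetic k : ℂ)) :=
    (hasFourier_L2 (ψ 0)).unique ((hφg.add ((hasFourier_rhoConvG ρ hε).const_mul q₀)).congr
      hψ.initial.symm Filter.EventuallyEq.rfl)
  have hfin : FiniteEnergy (𝓕 (ψ 0) : L2) := by
    refine ⟨integrable_norm_sq_L2 _, (integrable_kinetic_initial (ρ := ρ) hε q₀ hgm hg).congr ?_⟩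
    filter_upwards [hψF] with k hk
    rw [hk]
  have hmass : ‖ψ 0‖ ^ 2 ≤ M := by
    rw [norm_sq_eq_integral_fourier]
    refine le_trans (le_of_eq (integral_congr_ae ?_)) (hM ε hε hε1)
    filter_upwards [hψF] with k hk
    rw [hk]
  obtain ⟨hE0, hq0⟩ := initial_bounds hρ_int hε hε1 hgm hg hψF
  have key : ∀ t ∈ Icc (0 : ℝ) T,
      (Integrable fun k => kinetic k * ‖(𝓕 (ψ t) : L2) k‖ ^ 2) ∧
      Real.sqrt (regularEnergy ρ ε (ψ t)) ≤ X ∧ ‖charge ρ ε (ψ t)‖ ^ 2 ≤ K * (1 + X) := by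
    intro t ht
    obtain ⟨hkin, hm, hE⟩ := hψ.conservation hρ_int hε hμ hfin ht
    have hE_nonneg : 0 ≤ regularEnergy ρ ε (ψ t) :=
      integral_nonneg fun k => mul_nonneg (kinetic_nonneg k) (by positivity)
    have hDsq := Real.sq_sqrt hE_nonneg
    have hch := hcharge ε hε (ψ t) (hm.trans_le hmass) _ (Real.sqrt_nonneg _)
      (regularEnergy_eq ρ hρ_int hε _ hkin).1 hDsq.ge
    have hD : Real.sqrt (regularEnergy ρ ε (ψ t)) ≤ X := by
      refine hbound _ _ (Real.sqrt_nonneg _) (sq_nonneg _) hch ?_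
      rw [hDsq, hE]
      have h1 : γ / (μ + 1) * (‖charge ρ ε (ψ 0)‖ ^ 2) ^ (μ + 1) ≤
          |γ| / (μ + 1) * Q₀ ^ (μ + 1) := by
        gcongr
        exact le_abs_self γ
      linarith
    exact ⟨hkin, hD, hch.trans (by gcongr)⟩
  have hKX : 0 ≤ K * (1 + X) := by positivity
  refine ⟨fun t ht => ?_, fun t ht => ?_⟩
  · refine (gradNorm_regularPart_le ρ hρ_int hε (ψ t) (key t ht).1).trans ?_
    exact ENNReal.ofReal_le_ofReal (by linarith [(key t ht).2.1])
  · nlinarith [(key t ht).2.2, norm_nonneg (charge ρ ε (ψ t)),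
      sq_nonneg (‖charge ρ ε (ψ t)‖ - 1)]
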